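/- **Setting.** Let $\mathcal M$ be a finite set of arcs $I_i=(0,L_i)$, $L_i>0$, of a star-shaped network, partitioned into the non-empty sets $\mathcal I$ of arcs incoming in the inner node $N$ and $\mathcal O$ of arcs outgoing from it. For $i\in\mathcal I$ let $N$ correspond to $x=L_i$ and the outer node $e_i$ to $x=0$, and set $\beta_i=1$; for $i\in\mathcal O$ let $N$ correspond to $x=0$ and $e_i$ to $x=L_i$, and set $\beta_i=-1$. Let $\epsilon>0$, $\lambda_i>0$, $K_{ij}=K_{ji}\ge 0$ ($i,j\in\mathcal M$). Let $L^1(\mathcal A)=\prod_i L^1(I_i)$ and $W^{2,1}(\mathcal A)=\prod_i W^{2,1}(I_i)$ (real-valued functions), with $\|f\|=\sum_i\|f_i\|$; values of $w_i$ and $w_{ix}$ at end points are those of the continuous representatives. We say that $w\in W^{2,1}(\mathcal A)$ satisfies the transmission conditions if $$\beta_i\bigl(-\lambda_i w_i(N)+\epsilon w_{ix}(N)\bigr)=\sum_{j\in\mathcal M}K_{ij}\bigl(w_j(N)-w_i(N)\bigr)\qquad(i\in\mathcal M).\tag{T}$$ Let $A_0^\epsilon$ be the operator in $L^1(\mathcal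 A)$ with domain $D(A_0^\epsilon)=\{w\in W^{2,1}(\mathcal A): w_i(e_i)=0\ (i\in\mathcal M),\ w\text{ satisfies (T)}\}$ and $A_0^\epsilon w=\{\epsilon w_{ixx}-\lambda_i w_{ix}\}_{i\in\mathcal M}$. **Theorem.** The operator $A_0^\epsilon$ is m-dissipative in $L^1(\mathcal A)$ (that is, $\|v-\theta A_0^\epsilon v\|\ge\|v\|$ for all $v\in D(A_0^\epsilon)$, $\theta>0$, and for some $\theta_0>0$ the equation $v-\theta_0A_0^\epsilon v=f$ has a solution $v\in D(A_0^\epsilon)$ for every $f\in L^1(\mathcal A)$), and it is the generator of exactly one strongly continuous contraction semigroup $\tau_\epsilon$ on $L^1(\mathcal A)$. For every $u_0^\epsilon\in W^{2,1}(\mathcal A)$ satisfying (T) there is a unique $$u^\epsilon\in C([0,\infty);W^{2,1}(\mathcal A))\cap C^1([0,\infty);L^1(\mathcal A))$$ such that $u^\epsilon_{it}=-\lambda_iu^\epsilon_{ix}+\epsilon u^\epsilon_{ixx}$ in $L^1(I_i)$ for $t>0$ and $i\in\mathcal M$, $u^\epsilon(0)=u^\epsilon_0$, $u^\epsilon(t)$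 satisfies (T) for $t>0$, and $u_i^\epsilon(e_i,t)=u_{0i}^\epsilon(e_i)$ for $t>0$ and $i\in\mathcal M$. Moreover there are $q=\{q_i\}_{i\in\mathcal M}$ with $q_i\in C^\infty([0,L_i])$, $q_i(e_i)=u^\epsilon_{0i}(e_i)$, $q_i(N)=q_i'(N)=0$, and for every such $q$, with $F=\{\epsilon q_i''-\lambda_iq_i'\}_{i\in\mathcal M}$, $$u^\epsilon(t)=\tau_\epsilon(t)(u_0^\epsilon-q)+\int_0^t\tau_\epsilon(t-s)F\,ds+q\qquad(t\ge0).$$ -/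

import Mathlib

open Set Filter Topology MeasureTheory
open scoped ContDiff NNReal

noncomputable section

/-! ### Function spaces on one arc `(0, ℓ)` -/

/-- The space `L¹(0, ℓ)`. -/
abbrev L1Arc (ℓ : ℝ) : Type := Lp ℝ 1 (volume.restrict (Ioo 0 ℓ))

/-- `g` is the weak (distributional) derivative of `f` on `(0, ℓ)`. -/
def IsWeakDeriv {ℓ : ℝ} (f g : L1Arc ℓ) : Prop :=
  ∀ φ : ℝ → ℝ, ContDiff ℝ ∞ φ → HasCompactSupport φ → tsupport φ ⊆ Ioo 0 ℓ →
    ∫ x in Ioo 0 ℓ, f x * deriv φ x = - ∫ x in Ioo 0 ℓ, g x * φ x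

theorem integrable_mul_test {ℓ : ℝ} (f : L1Arc ℓ) {ψ : ℝ → ℝ} (hψ : Continuous ψ)
    (hc : HasCompactSupport ψ) : Integrable (fun x => f x * ψ x) (volume.restrict (Ioo 0 ℓ)) := by
  obtain ⟨C, hC⟩ := hψ.bounded_above_of_compact_support hc
  exact (L1.integrable_coeFn f).mul_bdd hψ.aestronglyMeasurable (Eventually.of_forall hC)

theorem IsWeakDeriv.zero {ℓ : ℝ} : IsWeakDeriv (0 : L1Arc ℓ) 0 := by
  intro φ _ _ _
  have h : ∀ ψ : ℝ → ℝ, ∫ x in Ioo 0 ℓ, (0 : L1Arc ℓ) x * ψ x = 0 := by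
    intro ψ
    apply integral_eq_zero_of_ae
    filter_upwards [Lp.coeFn_zero ℝ 1 (volume.restrict (Ioo 0 ℓ))] with x hx
    rw [hx, Pi.zero_apply, zero_mul]
  rw [h, h, neg_zero]

theorem IsWeakDeriv.add {ℓ : ℝ} {f g f' g' : L1Arc ℓ} (h : IsWeakDeriv f g)
    (h' : IsWeakDeriv f' g') : IsWeakDeriv (f + f') (g + g') := by
  intro φ h1 h2 h3
  have key : ∀ (a b : L1Arc ℓ) (ψ : ℝ → ℝ), Continuous ψ → HasCompactSupport ψ →
      ∫ x in Ioo 0 ℓ, (a + b) x * ψ x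
        = (∫ x in Ioo 0 ℓ, a x * ψ x) + ∫ x in Ioo 0 ℓ, b x * ψ x := by
    intro a b ψ hψ hc
    rw [← integral_add (integrable_mul_test a hψ hc) (integrable_mul_test b hψ hc)]
    apply integral_congr_ae
    filter_upwards [Lp.coeFn_add a b] with x hx
    rw [hx, Pi.add_apply, add_mul]
  rw [key _ _ _ (h1.continuous_deriv (by simp)) h2.deriv, key _ _ _ h1.continuous h2,
    h φ h1 h2 h3, h' φ h1 h2 h3, neg_add]

theorem IsWeakDeriv.smul {ℓ : ℝ} (c : ℝ) {f g : L1Arc ℓ} (h : IsWeakDeriv f g) :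
    IsWeakDeriv (c • f) (c • g) := by
  intro φ h1 h2 h3
  have key : ∀ (a : L1Arc ℓ) (ψ : ℝ → ℝ),
      ∫ x in Ioo 0 ℓ, (c • a) x * ψ x = c * ∫ x in Ioo 0 ℓ, a x * ψ x := by
    intro a ψ
    rw [← integral_const_mul]
    apply integral_congr_ae
    filter_upwards [Lp.coeFn_smul c a] with x hx
    rw [hx, Pi.smul_apply, smul_eq_mul, mul_assoc]
  rw [key, key, h φ h1 h2 h3, mul_neg]

/-- The Sobolev space `W^{2,1}(0, ℓ)`: an element is a function `w 0 ∈ L¹` together with its first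
and second weak derivatives `w 1, w 2 ∈ L¹` (which it determines).  The norm is
`‖w‖ = ‖w 0‖₁ + ‖w 1‖₁ + ‖w 2‖₁`. -/
def W21Arc (ℓ : ℝ) : Submodule ℝ (PiLp 1 (fun _ : Fin 3 => L1Arc ℓ)) where
  carrier := {w | IsWeakDeriv (w 0) (w 1) ∧ IsWeakDeriv (w 1) (w 2)}
  add_mem' h h' := ⟨h.1.add h'.1, h.2.add h'.2⟩
  zero_mem' := ⟨IsWeakDeriv.zero, IsWeakDeriv.zero⟩
  smul_mem' c _ h := ⟨h.1.smul c, h.2.smul c⟩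

open Classical in
/-- The value at `x ∈ [0, ℓ]` of the continuous representative on `[0, ℓ]` of `f ∈ L¹(0, ℓ)`.  Every
`f` with a weak derivative in `L¹` has exactly one such representative. -/
def trace {ℓ : ℝ} (f : L1Arc ℓ) (x : ℝ) : ℝ :=
  if h : ∃ g : ℝ → ℝ, ContinuousOn g (Icc 0 ℓ) ∧ f =ᵐ[volume.restrict (Ioo 0 ℓ)] g
  then h.choose x else 0

/-- The trace does not depend on the choice of the continuous representative. -/
theorem trace_eq {ℓ : ℝ} (hℓ : 0 < ℓ) {f : L1Arc ℓ} {g : ℝ → ℝ} (hg : ContinuousOn g (Icc 0 ℓ))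
    (hfg : f =ᵐ[volume.restrict (Ioo 0 ℓ)] g) {x : ℝ} (hx : x ∈ Icc 0 ℓ) : trace f x = g x := by
  have h : ∃ g : ℝ → ℝ, ContinuousOn g (Icc 0 ℓ) ∧ f =ᵐ[volume.restrict (Ioo 0 ℓ)] g :=
    ⟨g, hg, hfg⟩
  have e : trace f x = h.choose x := by rw [trace, dif_pos h]
  rw [e]
  have hae : h.choose =ᵐ[volume.restrict (Icc 0 ℓ)] g := by
    rw [← Measure.restrict_congr_set (Ioo_ae_eq_Icc (μ := volume) (a := (0 : ℝ)) (b := ℓ))]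
    exact h.choose_spec.2.symm.trans hfg
  exact Measure.eqOn_Icc_of_ae_eq volume hℓ.ne hae h.choose_spec.1 hg hx

/-! ### Unbounded operators and contraction semigroups -/

section Semigroups

variable {X : Type*} [NormedAddCommGroup X] [NormedSpace ℝ X]

/-- An unbounded operator `A` in `X`, given by its graph `{(v, A v) : v ∈ D(A)}`, is m-dissipative:
`‖v - θ A v‖ ≥ ‖v‖` for all `v ∈ D(A)` and `θ > 0`, and for some `θ₀ > 0` the equation
`v - θ₀ A v = f` has a solution `v ∈ D(A)` for every `f ∈ X`. -/
def IsMDissipative (A : Set (X × X)) : Prop :=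
  (∀ p ∈ A, ∀ θ : ℝ, 0 < θ → ‖p.1‖ ≤ ‖p.1 - θ • p.2‖) ∧
  ∃ θ₀ : ℝ, 0 < θ₀ ∧ ∀ f : X, ∃ p ∈ A, p.1 - θ₀ • p.2 = f

variable (X) in
/-- A strongly continuous semigroup of linear contractions of `X`. -/
@[ext]
structure ContractionSemigroup where
  op : ℝ≥0 → X →L[ℝ] X
  op_zero : op 0 = ContinuousLinearMap.id ℝ X
  op_add : ∀ s t : ℝ≥0, op (s + t) = (op s).comp (op t)
  contraction : ∀ (t : ℝ≥0) (x : X), ‖op t x‖ ≤ ‖x‖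
  strongly_continuous : ∀ x : X, Continuous fun t => op t x

/-- The graph of the infinitesimal generator of a contraction semigroup `τ`: the pairs `(x, y)` with
`(τ(h) x - x) / h → y` in `X` as `h → 0⁺`. -/
def ContractionSemigroup.generator (τ : ContractionSemigroup X) : Set (X × X) :=
  {p | Tendsto (fun h : ℝ≥0 => (h : ℝ)⁻¹ • (τ.op h p.1 - p.1)) (𝓝[>] 0) (𝓝 p.2)}

end Semigroups

/-! ### The parabolic transmission problem on a star-shaped network -/

/-- A star-shaped network with arcs `(0, len i)`, each incoming in or outgoing from the inner node,
with the coefficients of the parabolic problem. -/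
structure StarNetwork (ι : Type*) [Fintype ι] where
  /-- lengths `L i` of the arcs -/
  len : ι → ℝ
  len_pos : ∀ i, 0 < len i
  /-- the set of the arcs incoming in the inner node; the other arcs are outgoing from it -/
  incoming : Set ι
  incoming_nonempty : incoming.Nonempty
  outgoing_nonempty : incomingᶜ.Nonempty
  /-- velocities `lam i` -/
  lam : ι → ℝ
  lam_pos : ∀ i, 0 < lam i
  /-- viscosity -/
  eps : ℝ
  eps_pos : 0 < eps
  /-- transmission coefficients `K i j` -/
  K : ι → ι → ℝ
  K_nonneg : ∀ i j, 0 ≤ K i j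
  K_symm : ∀ i j, K i j = K j i

namespace StarNetwork

variable {ι : Type*} [Fintype ι] (P : StarNetwork ι)

open Classical in
/-- The endpoint of arc `i` at the inner node `N`. -/
def innerEnd (i : ι) : ℝ := if i ∈ P.incoming then P.len i else 0

open Classical in
/-- The endpoint of arc `i` at its outer node `e i`. -/
def outerEnd (i : ι) : ℝ := if i ∈ P.incoming then 0 else P.len i

open Classical in
/-- `β i = 1` on incoming arcs and `β i = -1` on outgoing arcs. -/
def beta (i : ι) : ℝ := if i ∈ P.incoming then 1 else -1

/-- `L¹` of the network, with `‖f‖ = ∑ i, ‖f i‖₁`. -/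
abbrev L1 : Type _ := PiLp 1 (fun i : ι => L1Arc (P.len i))

/-- `W^{2,1}` of the network, with `‖w‖ = ∑ i, ‖w i‖`. -/
abbrev W21 : Type _ := PiLp 1 (fun i : ι => W21Arc (P.len i))

variable {P}

/-- The derivative of order `k ≤ 2` (in space) of `w`, as an element of `L¹`. -/
def W21.der (w : P.W21) (k : Fin 3) : P.L1 := WithLp.toLp 1 fun i => (w i).1 k

variable (P)

/-- The differential expression `ε w_xx - λ w_x`. -/
def diffOp (w : P.W21) : P.L1 :=
  WithLp.toLp 1 fun i => P.eps • W21.der w 2 i - P.lam i • W21.der w 1 i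

/-- The transmission conditions at the inner node:
`β i (-λ i w_i(N) + ε (w_i)_x(N)) = ∑ j, K i j (w_j(N) - w_i(N))` for every arc `i`. -/
def Transmission (w : P.W21) : Prop :=
  ∀ i, P.beta i * (-P.lam i * trace (W21.der w 0 i) (P.innerEnd i)
      + P.eps * trace (W21.der w 1 i) (P.innerEnd i))
    = ∑ j, P.K i j * (trace (W21.der w 0 j) (P.innerEnd j) - trace (W21.der w 0 i) (P.innerEnd i))

/-- The graph of the operator `A₀ w = ε w_xx - λ w_x` in `L¹`, whose domain consists of the
`w ∈ W^{2,1}` with `w_i(e_i) = 0` for all `i` and the transmission conditions. -/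
def A₀ : Set (P.L1 × P.L1) :=
  {p | ∃ w : P.W21, (∀ i, trace (W21.der w 0 i) (P.outerEnd i) = 0) ∧ P.Transmission w ∧
    p = (W21.der w 0, P.diffOp w)}

/-- `u` (on the times `t ≥ 0`) is a solution in `C([0,∞); W^{2,1}) ∩ C¹([0,∞); L¹)` of
`u_t = -λ u_x + ε u_xx` with initial value `u₀`, the transmission conditions at the inner node and
the boundary values `u_i(e_i, t) = u₀_i(e_i)` at the outer nodes. -/
structure IsSolution (u₀ : P.W21) (u : ℝ → P.W21) : Prop where
  continuousOn : ContinuousOn u (Ici 0)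
  contDiffOn : ContDiffOn ℝ 1 (fun t => W21.der (u t) 0) (Ici 0)
  equation : ∀ t > 0, HasDerivAt (fun s => W21.der (u s) 0) (P.diffOp (u t)) t
  initial : u 0 = u₀
  transmission : ∀ t > 0, P.Transmission (u t)
  boundary : ∀ t > 0, ∀ i,
    trace (W21.der (u t) 0 i) (P.outerEnd i) = trace (W21.der u₀ 0 i) (P.outerEnd i)

/-- `q_i ∈ C^∞([0, L i])`, `q_i(e_i) = u₀_i(e_i)` and `q_i(N) = q_i'(N) = 0` for every arc `i`. -/
structure IsLift (u₀ : P.W21) (q : ι → ℝ → ℝ) : Prop where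
  smooth : ∀ i, ContDiffOn ℝ ∞ (q i) (Icc 0 (P.len i))
  outer_eq : ∀ i, q i (P.outerEnd i) = trace (W21.der u₀ 0 i) (P.outerEnd i)
  inner_eq : ∀ i, q i (P.innerEnd i) = 0
  inner_deriv : ∀ i, derivWithin (q i) (Icc 0 (P.len i)) (P.innerEnd i) = 0

/-- `Q ∈ L¹` is the class of the family of functions `q`. -/
def IsClassOf (Q : P.L1) (q : ι → ℝ → ℝ) : Prop :=
  ∀ i, Q i =ᵐ[volume.restrict (Ioo 0 (P.len i))] q i

/-- The functions `F_i = ε q_i'' - λ i q_i'`. -/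
def source (q : ι → ℝ → ℝ) (i : ι) (x : ℝ) : ℝ :=
  P.eps * iteratedDerivWithin 2 (q i) (Icc 0 (P.len i)) x
    - P.lam i * derivWithin (q i) (Icc 0 (P.len i)) x

end StarNetwork

end

/-! Dissipativity comes from testing `v - θ A v` against a smooth approximation of the sign of `v`.
Integrating by parts on each arc, diffusion has a good sign and convection costs only `O(δ)`. The
outer boundary terms vanish. At `N` the transmission conditions turn the fluxes into `∑ i, (∑ j, K i
j * (a j - a i)) * S (a i)`, which is nonpositive because `K` is symmetric and nonnegative and `S`
is monotone (`norm_der_le`).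

For the range condition, the resolvent equation is a second order linear ODE on each arc. Two free
constants per arc face two conditions per arc, so the boundary conditions form a square linear
system; dissipativity makes it injective, hence solvable (`exists_mem_domain_resolvent`). The domain
is dense (`dense_domain`), and the Hille–Yosida theorem, proved through Yosida approximations
(`ResolventSeq.generator_semigroup`), yields the semigroup. It is unique because a densely defined
generator determines its semigroup.

Subtracting a lift `Q` of the outer data reduces the parabolic problem to `w' = A w + F` with `F`
constant in time. Its mild solution is classical, since the time integral of an orbit always lies in
the domain. Continuity in `W^{2,1}` follows because the graph norm controls the `W^{2,1}` norm
(`exists_norm_le`). The difference of two solutions is an orbit starting at `0`, which gives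
uniqueness, and uniqueness in turn gives the representation formula for every lift. -/

noncomputable section

/-! ### Contraction semigroups -/

namespace ContractionSemigroup

variable {X : Type*} [NormedAddCommGroup X] [NormedSpace ℝ X] (τ : ContractionSemigroup X)

/-- The orbit `t ↦ τ(t) x`, extended by the constant `x` to negative times. -/
def orbit (x : X) (t : ℝ) : X := τ.op t.toNNReal x

@[simp]
theorem orbit_zero (x : X) : τ.orbit x 0 = x := by simp [orbit, τ.op_zero]

theorem norm_orbit_le (x : X) (t : ℝ) : ‖τ.orbit x t‖ ≤ ‖x‖ := τ.contraction _ _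

theorem orbit_add_left (x y : X) (t : ℝ) : τ.orbit (x + y) t = τ.orbit x t + τ.orbit y t :=
  map_add _ _ _

theorem orbit_sub_left (x y : X) (t : ℝ) : τ.orbit (x - y) t = τ.orbit x t - τ.orbit y t :=
  map_sub _ _ _

theorem orbit_orbit (x : X) {s t : ℝ} (hs : 0 ≤ s) (ht : 0 ≤ t) :
    τ.orbit (τ.orbit x t) s = τ.orbit x (s + t) := by
  simp only [orbit]
  rw [Real.toNNReal_add hs ht, τ.op_add]
  rfl

theorem continuous_orbit (x : X) : Continuous (τ.orbit x) :=
  (τ.strongly_continuous x).comp continuous_real_toNNReal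

/-- Joint continuity: strong continuity handles the time, and contractivity makes the dependence on
the initial value uniform in time. -/
theorem tendsto_orbit {α : Type*} {l : Filter α} {s : α → ℝ} {y : α → X} {s₀ : ℝ} {y₀ : X}
    (hs : Tendsto s l (𝓝 s₀)) (hy : Tendsto y l (𝓝 y₀)) :
    Tendsto (fun a => τ.orbit (y a) (s a)) l (𝓝 (τ.orbit y₀ s₀)) := by
  have h1 : Tendsto (fun a => τ.orbit y₀ (s a)) l (𝓝 (τ.orbit y₀ s₀)) :=
    ((τ.continuous_orbit y₀).tendsto s₀).comp hs
  have h2 : Tendsto (fun a => τ.orbit (y a - y₀) (s a)) l (𝓝 0) := by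
    refine squeeze_zero_norm (fun a => τ.norm_orbit_le _ _) ?_
    simpa using (hy.sub_const y₀).norm
  refine (h1.add h2).congr' (Eventually.of_forall fun a => ?_) |>.trans (by simp)
  simp [orbit_sub_left]

theorem mem_generator_iff {p : X × X} :
    p ∈ τ.generator ↔ HasDerivWithinAt (τ.orbit p.1) p.2 (Ici 0) 0 := by
  rw [hasDerivWithinAt_iff_tendsto_slope, Set.Ici_sdiff_left]
  have e : Tendsto (fun h : ℝ => h.toNNReal) (𝓝[>] 0) (𝓝[>] 0) := by
    refine tendsto_nhdsWithin_iff.2 ⟨?_, ?_⟩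
    · have := continuous_real_toNNReal.tendsto 0
      rw [Real.toNNReal_zero] at this
      exact this.mono_left nhdsWithin_le_nhds
    · filter_upwards [self_mem_nhdsWithin] with h hh
      exact Real.toNNReal_pos.2 hh
  have e' : Tendsto (fun h : ℝ≥0 => (h : ℝ)) (𝓝[>] 0) (𝓝[>] 0) := by
    refine tendsto_nhdsWithin_iff.2 ⟨?_, ?_⟩
    · have := NNReal.continuous_coe.tendsto 0
      exact this.mono_left nhdsWithin_le_nhds
    · filter_upwards [self_mem_nhdsWithin] with h hh
      exact hh
  constructor
  · intro h
    have h' : Tendsto (fun h : ℝ≥0 => (h : ℝ)⁻¹ • (τ.op h p.1 - p.1)) (𝓝[>] 0) (𝓝 p.2) := h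
    refine (h'.comp e).congr' ?_
    filter_upwards [self_mem_nhdsWithin] with r hr
    simp [slope, orbit, τ.op_zero, max_eq_left (le_of_lt (mem_Ioi.1 hr))]
  · intro h
    refine (h.comp e').congr' (Eventually.of_forall fun r => ?_)
    simp [slope, orbit, τ.op_zero]

/-- `τ(t)` is bounded and commutes with `τ(s)`, so it passes through the difference quotient. -/
theorem orbit_mem_generator {x y : X} (h : (x, y) ∈ τ.generator) {t : ℝ} (ht : 0 ≤ t) :
    (τ.orbit x t, τ.orbit y t) ∈ τ.generator := by
  rw [mem_generator_iff] at h ⊢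
  have := (τ.op t.toNNReal).hasFDerivAt.comp_hasDerivWithinAt (0 : ℝ) h
  refine this.congr (fun s hs => ?_) ?_
  · rw [orbit_orbit _ _ hs ht, add_comm, ← orbit_orbit _ _ ht hs]
    rfl
  · simp [orbit, τ.op_zero]

theorem sub_mem_generator {p q : X × X} (hp : p ∈ τ.generator) (hq : q ∈ τ.generator) :
    p - q ∈ τ.generator := by
  rw [mem_generator_iff] at *
  refine (hp.sub hq).congr (fun s _ => ?_) ?_ <;> simp [orbit_sub_left]

theorem add_mem_generator {p q : X × X} (hp : p ∈ τ.generator) (hq : q ∈ τ.generator) :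
    p + q ∈ τ.generator := by
  rw [mem_generator_iff] at *
  refine (hp.add hq).congr (fun s _ => ?_) ?_ <;> simp [orbit_add_left]

/-- With `A` replaced by the difference quotient, the right side is at least `(1 + θ/h)‖x‖ -
(θ/h)‖τ(h) x‖ ≥ ‖x‖`; then `h → 0`. -/
theorem generator_dissipative {p : X × X} (hp : p ∈ τ.generator) {θ : ℝ} (hθ : 0 < θ) :
    ‖p.1‖ ≤ ‖p.1 - θ • p.2‖ := by
  have hp' : Tendsto (fun h : ℝ≥0 => (h : ℝ)⁻¹ • (τ.op h p.1 - p.1)) (𝓝[>] 0) (𝓝 p.2) := hp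
  have h1 := ((tendsto_const_nhds (x := p.1)).sub (hp'.const_smul θ)).norm
  have : (𝓝[>] (0 : ℝ≥0)).NeBot := nhdsGT_neBot _
  refine ge_of_tendsto h1 ?_
  filter_upwards [self_mem_nhdsWithin] with h hh
  have hh' : (0 : ℝ) < h := hh
  have e : p.1 - θ • (h : ℝ)⁻¹ • (τ.op h p.1 - p.1)
      = (1 + θ / h) • p.1 - (θ / h) • τ.op h p.1 := by
    rw [smul_smul, div_eq_mul_inv]
    module
  rw [e]
  have h2 := norm_sub_norm_le ((1 + θ / h) • p.1) ((θ / h) • τ.op h p.1)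
  rw [norm_smul, norm_smul, Real.norm_of_nonneg (by positivity),
    Real.norm_of_nonneg (by positivity)] at h2
  have h3 := mul_le_mul_of_nonneg_left (τ.contraction h p.1) (by positivity : 0 ≤ θ / h)
  linarith

/-- An m-dissipative restriction of the generator is the whole generator. -/
theorem generator_eq_of_subset {A : Set (X × X)} (hA : A ⊆ τ.generator) {θ : ℝ} (hθ : 0 < θ)
    (hsurj : ∀ f : X, ∃ p ∈ A, p.1 - θ • p.2 = f) : τ.generator = A := by
  refine Subset.antisymm (fun p hp => ?_) hA
  obtain ⟨q, hq, hqf⟩ := hsurj (p.1 - θ • p.2)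
  -- Dissipativity of the full generator makes `1 - θ A` injective on it, so `p` must be the
  -- preimage `q` found in the restriction.
  have h := τ.generator_dissipative (τ.sub_mem_generator hp (hA hq)) hθ
  have e : (p - q).1 - θ • (p - q).2 = 0 := by
    simp only [Prod.fst_sub, Prod.snd_sub, smul_sub]
    rw [← sub_eq_zero] at hqf
    rw [← neg_eq_zero, ← hqf]
    abel
  rw [e, norm_zero] at h
  have h1 : p.1 = q.1 := sub_eq_zero.1 (norm_le_zero_iff.1 h)
  rw [h1, sub_right_inj] at hqf
  have h2 : q.2 = p.2 := smul_right_injective X hθ.ne' hqf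
  rwa [Prod.ext h1 h2.symm]

theorem hasDerivWithinAt_orbit {x y : X} (h : (x, y) ∈ τ.generator) {t : ℝ} (ht : 0 ≤ t) :
    HasDerivWithinAt (τ.orbit x) (τ.orbit y t) (Ici t) t := by
  have h1 := τ.mem_generator_iff.1 (τ.orbit_mem_generator h ht)
  have h2 : HasDerivWithinAt (fun s => τ.orbit (τ.orbit x t) (s - t)) (τ.orbit y t) (Ici t) t := by
    have := HasDerivWithinAt.scomp_of_eq (h := fun s => s - t) (h' := 1) (s := Ici t) t h1
      ((hasDerivAt_id t).sub_const t).hasDerivWithinAt (fun s hs => by simpa using hs) (by simp)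
    rwa [one_smul] at this
  refine h2.congr (fun s hs => ?_) ?_
  · rw [orbit_orbit _ _ (sub_nonneg.2 hs) ht]; simp
  · simp

variable [CompleteSpace X]

theorem hasDerivAt_integral_orbit (x : X) (t : ℝ) :
    HasDerivAt (fun r => ∫ s in (0 : ℝ)..r, τ.orbit x s) (τ.orbit x t) t :=
  intervalIntegral.integral_hasDerivAt_right ((τ.continuous_orbit x).intervalIntegrable _ _)
    ((τ.continuous_orbit x).stronglyMeasurableAtFilter _ _)
    (τ.continuous_orbit x).continuousAt

/-- Only right derivatives of the orbit are known so far. Both sides are continuous with equal right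
derivatives, and the integral form then supplies the two-sided derivative. -/
theorem orbit_eq_add_integral {x y : X} (h : (x, y) ∈ τ.generator) {t : ℝ} (ht : 0 ≤ t) :
    τ.orbit x t = x + ∫ s in (0 : ℝ)..t, τ.orbit y s := by
  refine eq_of_has_deriv_right_eq (a := 0) (b := t)
    (fun s hs => τ.hasDerivWithinAt_orbit h hs.1)
    (fun s _ => ((τ.hasDerivAt_integral_orbit y s).const_add x).hasDerivWithinAt)
    (τ.continuous_orbit x).continuousOn ?_ (by simp) t ⟨ht, le_rfl⟩
  exact fun s _ =>
    ((τ.hasDerivAt_integral_orbit y s).const_add x).continuousAt.continuousWithinAt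

theorem hasDerivWithinAt_orbit_Ici {x y : X} (h : (x, y) ∈ τ.generator) {t : ℝ} (ht : 0 ≤ t) :
    HasDerivWithinAt (τ.orbit x) (τ.orbit y t) (Ici 0) t :=
  ((τ.hasDerivAt_integral_orbit y t).const_add x).hasDerivWithinAt.congr
    (fun _ hs => τ.orbit_eq_add_integral h hs) (τ.orbit_eq_add_integral h ht)

theorem hasDerivAt_orbit {x y : X} (h : (x, y) ∈ τ.generator) {t : ℝ} (ht : 0 < t) :
    HasDerivAt (τ.orbit x) (τ.orbit y t) t :=
  (τ.hasDerivWithinAt_orbit_Ici h ht.le).hasDerivAt (Ici_mem_nhds ht)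

/-- No regularity of `x` is needed: `τ(h)` shifts the integral to `[h, h + t]`, that is, to the
difference of the integrals over `[0, h + t]` and `[0, h]`, which is differentiable at `h = 0`. -/
theorem integral_orbit_mem_generator (x : X) {t : ℝ} (ht : 0 ≤ t) :
    (∫ s in (0 : ℝ)..t, τ.orbit x s, τ.orbit x t - x) ∈ τ.generator := by
  have hi : ∀ a b : ℝ, IntervalIntegrable (τ.orbit x) volume a b :=
    fun a b => (τ.continuous_orbit x).intervalIntegrable a b
  rw [mem_generator_iff]
  have h1 : HasDerivAt (fun h => ∫ s in (0 : ℝ)..(h + t), τ.orbit x s) (τ.orbit x t) 0 := by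
    have := (τ.hasDerivAt_integral_orbit x (0 + t)).comp_add_const 0 t
    simpa using this
  have h2 := τ.hasDerivAt_integral_orbit x 0
  rw [orbit_zero] at h2
  refine (h1.sub h2).hasDerivWithinAt.congr (fun h hh => ?_) ?_
  · change τ.op h.toNNReal (∫ s in (0 : ℝ)..t, τ.orbit x s)
      = (∫ s in (0 : ℝ)..(h + t), τ.orbit x s) - ∫ s in (0 : ℝ)..h, τ.orbit x s
    rw [← ContinuousLinearMap.intervalIntegral_comp_comm _ (hi 0 t)]
    have : ∀ s ∈ uIcc 0 t, τ.op h.toNNReal (τ.orbit x s) = τ.orbit x (h + s) := fun s hs => by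
      rw [uIcc_of_le ht] at hs
      exact τ.orbit_orbit x hh hs.1
    rw [intervalIntegral.integral_congr this, intervalIntegral.integral_comp_add_left,
      eq_sub_iff_add_eq', add_zero]
    exact intervalIntegral.integral_add_adjacent_intervals (hi _ _) (hi _ _)
  · simp

/-- A product rule for a merely strongly continuous `τ`. Writing `d r = d s + (d r - d s)`, the
first part contributes `-τ(t - s) d'` by the generator, the second `τ(t - s) d'` by joint
continuity, and they cancel. -/
theorem hasDerivAt_orbit_sub {t s : ℝ} (hst : s < t) {d : ℝ → X} {d' : X}
    (hd : HasDerivAt d d' s) (hg : (d s, d') ∈ τ.generator) :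
    HasDerivAt (fun r => τ.orbit (d r) (t - r)) 0 s := by
  have h1 : HasDerivAt (fun r => τ.orbit (d s) (t - r)) (-τ.orbit d' (t - s)) s :=
    (τ.hasDerivAt_orbit hg (sub_pos.2 hst)).comp_const_sub t s
  have h2 : HasDerivAt (fun r => τ.orbit (d r - d s) (t - r)) (τ.orbit d' (t - s)) s := by
    rw [hasDerivAt_iff_tendsto_slope] at hd ⊢
    have := τ.tendsto_orbit (l := 𝓝[≠] s) (s := fun r => t - r) (s₀ := t - s)
      ((continuous_const.sub continuous_id).tendsto s |>.mono_left nhdsWithin_le_nhds) hd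
    refine this.congr fun r => ?_
    simp [slope, orbit]
  have := h1.add h2
  rw [neg_add_cancel] at this
  refine this.congr_of_eventuallyEq (Eventually.of_forall fun r => ?_)
  simp [orbit_sub_left]

/-- A solution of the abstract Cauchy problem is an orbit of the semigroup. -/
theorem eq_orbit_of_hasDerivAt {t : ℝ} (ht : 0 ≤ t) {d d' : ℝ → X}
    (hc : ContinuousOn d (Icc 0 t)) (hd : ∀ s ∈ Ioo 0 t, HasDerivAt d (d' s) s)
    (hg : ∀ s ∈ Ioo 0 t, (d s, d' s) ∈ τ.generator) : d t = τ.orbit (d 0) t := by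
  rcases ht.eq_or_lt with rfl | ht
  · simp
  have hφ : ContinuousOn (fun r => τ.orbit (d r) (t - r)) (Icc 0 t) := fun s hs =>
    τ.tendsto_orbit ((continuous_const.sub continuous_id).continuousWithinAt) (hc s hs)
  -- The equation holds only at positive times, so `r ↦ τ(t - r) d(r)` is shown to be constant on
  -- `[a, t]`, and then `a → 0`.
  have h1 : ∀ a ∈ Ioo 0 t, d t = τ.orbit (d a) (t - a) := fun a ha => by
    have := constant_of_has_deriv_right_zero (f := fun r => τ.orbit (d r) (t - r)) (a := a) (b := t)
      (hφ.mono (Icc_subset_Icc_left ha.1.le)) (fun s hs =>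
        (τ.hasDerivAt_orbit_sub hs.2 (hd s ⟨ha.1.trans_le hs.1, hs.2⟩)
          (hg s ⟨ha.1.trans_le hs.1, hs.2⟩)).hasDerivWithinAt) t ⟨ha.2.le, le_rfl⟩
    simpa using this
  have h2 : Tendsto (fun r => τ.orbit (d r) (t - r)) (𝓝[>] 0) (𝓝 (τ.orbit (d 0) t)) := by
    have := (hφ 0 ⟨le_rfl, ht.le⟩).tendsto
    rw [sub_zero] at this
    refine this.mono_left ?_
    rw [← nhdsWithin_Ioo_eq_nhdsGT ht]
    exact nhdsWithin_mono _ Ioo_subset_Icc_self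
  refine tendsto_nhds_unique (tendsto_const_nhds.congr' ?_) h2
  filter_upwards [Ioo_mem_nhdsGT ht] with a ha using h1 a ha

/-- A semigroup with densely defined generator is determined by its generator. -/
theorem eq_of_generator_eq {σ : ContractionSemigroup X} (h : σ.generator = τ.generator)
    (hd : Dense (Prod.fst '' τ.generator)) : σ = τ := by
  ext t x
  have : (fun x => σ.op t x) = fun x => τ.op t x := by
    refine Continuous.ext_on hd (σ.op t).continuous (τ.op t).continuous ?_
    rintro _ ⟨⟨x, y⟩, hxy, rfl⟩
    -- On the domain, an orbit of `σ` solves the Cauchy problem of `τ`; density and continuity do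
    -- the rest.
    have := τ.eq_orbit_of_hasDerivAt (d := σ.orbit x) (d' := σ.orbit y) t.coe_nonneg
      (σ.continuous_orbit x).continuousOn
      (fun s hs => σ.hasDerivAt_orbit (h ▸ hxy) hs.1)
      (fun s hs => h ▸ σ.orbit_mem_generator (h ▸ hxy) hs.1.le)
    simpa [orbit, σ.op_zero] using this
  exact congrFun this x

end ContractionSemigroup

/-! ### The Hille–Yosida theorem for m-dissipative operators -/

/-- The exponential of `c (J - 1)` is a contraction if `J` is. -/
theorem norm_exp_smul_sub_one_le {X : Type*} [NormedAddCommGroup X] [NormedSpace ℝ X]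
    [CompleteSpace X] {J : X →L[ℝ] X} (hJ : ‖J‖ ≤ 1) {c : ℝ} (hc : 0 ≤ c) :
    ‖NormedSpace.exp (c • (J - 1))‖ ≤ 1 := by
  have hpow : ∀ n : ℕ, ‖J ^ n‖ ≤ 1 := by
    intro n
    induction n with
    | zero => exact ContinuousLinearMap.norm_id_le
    | succ k ih =>
      rw [pow_succ]
      exact (norm_mul_le _ _).trans (mul_le_one₀ ih (norm_nonneg _) hJ)
  have h1 : ‖NormedSpace.exp (c • J)‖ ≤ Real.exp c := by
    have hs := NormedSpace.exp_series_hasSum_exp' (𝕂 := ℝ) (c • J)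
    have hr := NormedSpace.exp_series_hasSum_exp' (𝕂 := ℝ) c
    rw [← Real.exp_eq_exp_ℝ] at hr
    refine hs.norm_le_of_bounded hr fun n => ?_
    rw [smul_pow, norm_smul, norm_smul, Real.norm_of_nonneg (by positivity),
      Real.norm_of_nonneg (by positivity), smul_eq_mul]
    exact mul_le_mul_of_nonneg_left (mul_le_of_le_one_right (by positivity) (hpow n))
      (by positivity)
  -- Scalars commute with `J`, so a factor `e^{-c}` splits off and cancels the bound `e^c`.
  have h2 : NormedSpace.exp (c • (J - 1)) = Real.exp (-c) • NormedSpace.exp (c • J) := by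
    have e : c • (J - 1) = algebraMap ℝ (X →L[ℝ] X) (-c) + c • J := by
      rw [Algebra.algebraMap_eq_smul_one]; module
    let _ : NormedAlgebra ℚ (X →L[ℝ] X) := NormedAlgebra.restrictScalars ℚ ℝ _
    rw [e, NormedSpace.exp_add_of_commute (Algebra.commutes _ _),
      ← NormedSpace.algebraMap_exp_comm, ← Real.exp_eq_exp_ℝ]
    exact (Algebra.smul_def _ _).symm
  rw [h2, norm_smul, Real.norm_of_nonneg (Real.exp_pos _).le, Real.exp_neg]
  exact (mul_le_mul_of_nonneg_left h1 (by positivity)).trans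
    (inv_mul_cancel₀ (Real.exp_pos c).ne').le

/-- Resolvents `J n = (1 - θ n A)⁻¹` of an unbounded operator `A` for a null sequence `θ`. -/
structure ResolventSeq {X : Type*} [NormedAddCommGroup X] [NormedSpace ℝ X]
    (A : Submodule ℝ (X × X)) where
  θ : ℕ → ℝ
  θ_pos : ∀ n, 0 < θ n
  θ_tendsto : Tendsto θ atTop (𝓝 0)
  J : ℕ → X →L[ℝ] X
  norm_apply_le : ∀ n x, ‖J n x‖ ≤ ‖x‖
  apply_sub : ∀ n, ∀ p ∈ A, J n (p.1 - θ n • p.2) = p.1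
  mem : ∀ n f, (J n f, (θ n)⁻¹ • (J n f - f)) ∈ A

namespace ResolventSeq

variable {X : Type*} [NormedAddCommGroup X] [NormedSpace ℝ X] {A : Submodule ℝ (X × X)}

/-- Dissipativity makes the solution of `p.1 - θ • p.2 = f` unique, hence linear in `f`, and bounds
it by `‖f‖`. -/
theorem exists_of_dissipative (hdiss : ∀ p ∈ A, ∀ θ : ℝ, 0 < θ → ‖p.1‖ ≤ ‖p.1 - θ • p.2‖)
    (hsurj : ∀ θ : ℝ, 0 < θ → ∀ f : X, ∃ p ∈ A, p.1 - θ • p.2 = f) :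
    Nonempty (ResolventSeq A) := by
  have key : ∀ θ : ℝ, 0 < θ → ∃ J : X →L[ℝ] X, (∀ x, ‖J x‖ ≤ ‖x‖) ∧
      (∀ p ∈ A, J (p.1 - θ • p.2) = p.1) ∧ ∀ f, (J f, θ⁻¹ • (J f - f)) ∈ A := by
    intro θ hθ
    have huniq : ∀ p ∈ A, ∀ q ∈ A, p.1 - θ • p.2 = q.1 - θ • q.2 → p.1 = q.1 := by
      intro p hp q hq h
      have h1 := hdiss _ (A.sub_mem hp hq) θ hθ
      have e : (p - q).1 - θ • (p - q).2 = 0 := by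
        rw [← sub_eq_zero] at h
        rw [← h]
        simp only [Prod.fst_sub, Prod.snd_sub, smul_sub]
        abel
      rw [e, norm_zero] at h1
      exact sub_eq_zero.1 (norm_le_zero_iff.1 h1)
    choose R hRA hR using hsurj θ hθ
    have hsnd : ∀ f, (R f).2 = θ⁻¹ • ((R f).1 - f) := by
      intro f
      rw [← smul_right_injective X hθ.ne' |>.eq_iff, smul_smul, mul_inv_cancel₀ hθ.ne', one_smul]
      nth_rw 3 [← hR f]
      abel
    have hadd : ∀ f g, (R (f + g)).1 = (R f).1 + (R g).1 := fun f g => by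
      refine huniq _ (hRA _) _ (A.add_mem (hRA f) (hRA g)) ?_
      rw [hR]
      nth_rw 1 [← hR f, ← hR g]
      simp only [Prod.fst_add, Prod.snd_add, smul_add]
      abel
    have hsmul : ∀ (c : ℝ) f, (R (c • f)).1 = c • (R f).1 := fun c f => by
      refine huniq _ (hRA _) _ (A.smul_mem c (hRA f)) ?_
      rw [hR]
      nth_rw 1 [← hR f]
      simp only [Prod.smul_fst, Prod.smul_snd, smul_sub, smul_comm c θ]
    let L : X →ₗ[ℝ] X := { toFun := fun f => (R f).1, map_add' := hadd, map_smul' := hsmul }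
    have hL : ∀ x, ‖L x‖ ≤ 1 * ‖x‖ := fun x => by
      have := hdiss _ (hRA x) θ hθ
      rwa [hR, ← one_mul ‖x‖] at this
    refine ⟨L.mkContinuous 1 hL, fun x => by simpa using hL x, fun p hp => ?_, fun f => ?_⟩
    · exact huniq _ (hRA _) _ hp (hR _)
    · have := hRA f
      rw [← Prod.mk.eta (p := R f), hsnd] at this
      exact this
  choose J h1 h2 h3 using fun n : ℕ => key (1 / ((n : ℝ) + 1)) (by positivity)
  exact ⟨⟨fun n => 1 / ((n : ℝ) + 1), fun n => by positivity,
    tendsto_one_div_add_atTop_nhds_zero_nat, J, h1, h2, h3⟩⟩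

variable (R : ResolventSeq A)

theorem norm_J_le (n : ℕ) : ‖R.J n‖ ≤ 1 :=
  ContinuousLinearMap.opNorm_le_bound _ zero_le_one fun x => by simpa using R.norm_apply_le n x

theorem mem_map_J {p : X × X} (hp : p ∈ A) (n : ℕ) : (R.J n p.1, R.J n p.2) ∈ A := by
  have h := R.mem n p.1
  have h1 := R.apply_sub n p hp
  have h2 : (R.θ n)⁻¹ • (R.J n p.1 - p.1) = R.J n p.2 := by
    nth_rw 2 [← h1]
    rw [← map_sub, sub_sub_cancel, map_smul, smul_smul, inv_mul_cancel₀ (R.θ_pos n).ne', one_smul]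
  rwa [h2] at h

theorem commute_J (n m : ℕ) : Commute (R.J n) (R.J m) := by
  ext f
  have h := R.apply_sub m _ (R.mem_map_J (R.mem m f) n)
  simp only [map_smul, map_sub, smul_smul, mul_inv_cancel₀ (R.θ_pos m).ne', one_smul] at h
  rw [← map_sub, ← map_sub, sub_sub_cancel] at h
  exact h.symm

/-- The Yosida approximation of `A`. -/
def yosida (n : ℕ) : X →L[ℝ] X := (R.θ n)⁻¹ • (R.J n - 1)

/-- On the domain the approximation equals `J n A`, which tends to `A` because `J n → 1` strongly.
-/
theorem yosida_apply {x y : X} (h : (x, y) ∈ A) (n : ℕ) : R.yosida n x = R.J n y := by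
  have h1 : R.J n (x - R.θ n • y) = x := R.apply_sub n _ h
  change (R.θ n)⁻¹ • (R.J n x - x) = R.J n y
  nth_rw 2 [← h1]
  rw [← map_sub, sub_sub_cancel, map_smul, smul_smul, inv_mul_cancel₀ (R.θ_pos n).ne', one_smul]

theorem commute_yosida (n m : ℕ) : Commute (R.yosida n) (R.yosida m) :=
  ((((R.commute_J n m).sub_left (Commute.one_left _)).sub_right
    (Commute.one_right _)).smul_left _).smul_right _

/-- The semigroups generated by the Yosida approximations. -/
def approx (n : ℕ) (t : ℝ) : X →L[ℝ] X := NormedSpace.exp (t • R.yosida n)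

/-- On the domain `J n x - x = θ n • J n (A x)` tends to `0`; contractivity extends this to the
closure. -/
theorem tendsto_J (hd : Dense (Prod.fst '' (A : Set (X × X)))) (y : X) :
    Tendsto (fun n => R.J n y) atTop (𝓝 y) := by
  rw [Metric.tendsto_atTop]
  intro ε hε
  obtain ⟨_, hyx, ⟨x, z⟩, hxz, rfl⟩ := Metric.dense_iff.1 hd y (ε / 3) (by positivity)
  rw [Metric.mem_ball, dist_eq_norm] at hyx
  have h1 : Tendsto (fun n => R.θ n * ‖z‖) atTop (𝓝 0) := by
    simpa using R.θ_tendsto.mul_const ‖z‖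
  obtain ⟨N, hN⟩ := eventually_atTop.1 (h1.eventually (gt_mem_nhds (show 0 < ε / 3 by positivity)))
  refine ⟨N, fun n hn => ?_⟩
  have h2 : ‖R.J n x - x‖ ≤ R.θ n * ‖z‖ := by
    have e := R.yosida_apply hxz n
    have e' : R.J n x - x = R.θ n • R.J n z := by
      rw [← e]
      change _ = R.θ n • (R.θ n)⁻¹ • (R.J n x - x)
      rw [smul_smul, mul_inv_cancel₀ (R.θ_pos n).ne', one_smul]
    rw [e', norm_smul, Real.norm_of_nonneg (R.θ_pos n).le]
    exact mul_le_mul_of_nonneg_left (R.norm_apply_le n z) (R.θ_pos n).le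
  have h3 := R.norm_apply_le n (x - y)
  rw [map_sub] at h3
  have e : R.J n y - y = (R.J n x - x) - (R.J n x - R.J n y) + (x - y) := by abel
  rw [dist_eq_norm, e]
  calc _ ≤ ‖R.J n x - x‖ + ‖R.J n x - R.J n y‖ + ‖x - y‖ :=
        (norm_add_le _ _).trans (add_le_add_left (norm_sub_le _ _) _)
    _ < ε := by
        have := hN n hn
        dsimp only at hyx
        linarith

variable [CompleteSpace X]

theorem norm_approx_le (n : ℕ) {t : ℝ} (ht : 0 ≤ t) : ‖R.approx n t‖ ≤ 1 := by
  rw [approx, yosida, smul_smul]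
  exact norm_exp_smul_sub_one_le (R.norm_J_le n) (mul_nonneg ht (inv_nonneg.2 (R.θ_pos n).le))

theorem norm_approx_apply_le (n : ℕ) {t : ℝ} (ht : 0 ≤ t) (x : X) : ‖R.approx n t x‖ ≤ ‖x‖ := by
  simpa using (R.approx n t).le_of_opNorm_le (R.norm_approx_le n ht) x

theorem approx_add (n : ℕ) (s t : ℝ) : R.approx n (s + t) = R.approx n s * R.approx n t := by
  let _ : NormedAlgebra ℚ (X →L[ℝ] X) := NormedAlgebra.restrictScalars ℚ ℝ _
  rw [approx, add_smul]
  exact NormedSpace.exp_add_of_commute (((Commute.refl _).smul_left _).smul_right _)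

theorem hasDerivAt_approx (n : ℕ) (t : ℝ) :
    HasDerivAt (R.approx n) (R.approx n t * R.yosida n) t :=
  hasDerivAt_exp_smul_const (R.yosida n) t

theorem hasDerivAt_approx_apply (n : ℕ) (t : ℝ) (x : X) :
    HasDerivAt (fun s => R.approx n s x) (R.approx n t (R.yosida n x)) t := by
  simpa using (R.hasDerivAt_approx n t).clm_apply (hasDerivAt_const t x)

/-- The path `s ↦ e^{s A_n} e^{(t-s) A_m} x` joins the two terms. As the approximations commute, its
derivative is a product of contractions applied to `A_n x - A_m x`, and the mean value inequality
applies. -/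
theorem norm_approx_sub_le (n m : ℕ) {t : ℝ} (ht : 0 ≤ t) (x : X) :
    ‖R.approx n t x - R.approx m t x‖ ≤ ‖R.yosida n x - R.yosida m x‖ * t := by
  let _ : NormedAlgebra ℚ (X →L[ℝ] X) := NormedAlgebra.restrictScalars ℚ ℝ _
  have hcomm : ∀ s, Commute (R.yosida n) (R.approx m s) := fun s =>
    ((R.commute_yosida n m).smul_right s).exp_right
  have hder : ∀ s : ℝ, HasDerivAt (fun s => R.approx n s (R.approx m (t - s) x))
      (R.approx n s (R.approx m (t - s) (R.yosida n x - R.yosida m x))) s := by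
    intro s
    have h1 := (R.hasDerivAt_approx_apply m (t - s) x).comp_const_sub t s
    have h2 := (R.hasDerivAt_approx n s).clm_apply h1
    refine h2.congr_deriv ?_
    have : R.yosida n (R.approx m (t - s) x) = R.approx m (t - s) (R.yosida n x) :=
      congrArg (fun L : X →L[ℝ] X => L x) (hcomm (t - s)).eq
    simp only [mul_apply_eq_comp, this, map_sub, map_neg]
    abel
  have := norm_image_sub_le_of_norm_deriv_le_segment' (a := 0) (b := t)
    (C := ‖R.yosida n x - R.yosida m x‖)
    (fun s _ => (hder s).hasDerivWithinAt) (fun s hs => ?_) t ⟨ht, le_rfl⟩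
  · simpa [approx] using this
  · exact (R.norm_approx_apply_le n hs.1 _).trans
      (R.norm_approx_apply_le m (sub_nonneg.2 hs.2.le) _)

theorem norm_approx_sub_approx_le (n : ℕ) {s t : ℝ} (hs : 0 ≤ s) (ht : 0 ≤ t) (x : X) :
    ‖R.approx n t x - R.approx n s x‖ ≤ ‖R.yosida n x‖ * ‖t - s‖ :=
  (convex_Ici (0 : ℝ)).norm_image_sub_le_of_norm_hasDerivWithin_le
    (fun r _ => (R.hasDerivAt_approx_apply n r x).hasDerivWithinAt)
    (fun _ hr => R.norm_approx_apply_le n hr _) hs ht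

/-- For `x` in the domain, `A_n x = J n (A x)` is a Cauchy sequence, hence so is the sequence of
orbits; other `x` are approximated. -/
theorem exists_limit (hd : Dense (Prod.fst '' (A : Set (X × X)))) {t : ℝ} (ht : 0 ≤ t) (x : X) :
    ∃ y, Tendsto (fun n => R.approx n t x) atTop (𝓝 y) := by
  refine cauchySeq_tendsto_of_complete ?_
  rw [Metric.cauchySeq_iff]
  intro ε hε
  obtain ⟨_, hyx, ⟨x', z⟩, hxz, rfl⟩ := Metric.dense_iff.1 hd x (ε / 3) (by positivity)
  rw [Metric.mem_ball, dist_eq_norm] at hyx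
  obtain ⟨N, hN⟩ := Metric.cauchySeq_iff.1 (R.tendsto_J hd z).cauchySeq (ε / 3 / (t + 1))
    (by positivity)
  refine ⟨N, fun n hn m hm => ?_⟩
  have h1 := R.norm_approx_sub_le n m ht x'
  rw [R.yosida_apply hxz, R.yosida_apply hxz] at h1
  have h2 := hN n hn m hm
  rw [dist_eq_norm, lt_div_iff₀ (by positivity)] at h2
  have h3 := R.norm_approx_apply_le n ht (x' - x)
  have h4 := R.norm_approx_apply_le m ht (x' - x)
  rw [map_sub] at h3 h4
  have h5 : ‖R.J n z - R.J m z‖ * t ≤ ‖R.J n z - R.J m z‖ * (t + 1) := by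
    gcongr; linarith
  have e : R.approx n t x - R.approx m t x = (R.approx n t x' - R.approx m t x')
      - (R.approx n t x' - R.approx n t x) + (R.approx m t x' - R.approx m t x) := by abel
  rw [dist_eq_norm, e]
  refine ((norm_add_le _ _).trans (add_le_add_left (norm_sub_le _ _) _)).trans_lt ?_
  dsimp only at hyx
  linarith

/-- The limit of the semigroups generated by the Yosida approximations. -/
def limit (hd : Dense (Prod.fst '' (A : Set (X × X)))) (t : ℝ≥0) : X →L[ℝ] X :=
  continuousLinearMapOfTendsto (fun n => R.approx n t)
    (tendsto_pi_nhds.2 fun x => (R.exists_limit hd t.coe_nonneg x).choose_spec)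

variable (hd : Dense (Prod.fst '' (A : Set (X × X))))

theorem tendsto_approx (t : ℝ≥0) (x : X) :
    Tendsto (fun n => R.approx n t x) atTop (𝓝 (R.limit hd t x)) :=
  (R.exists_limit hd t.coe_nonneg x).choose_spec

theorem norm_limit_le (t : ℝ≥0) (x : X) : ‖R.limit hd t x‖ ≤ ‖x‖ :=
  le_of_tendsto (R.tendsto_approx hd t x).norm
    (Eventually.of_forall fun n => R.norm_approx_apply_le n t.coe_nonneg x)

theorem tendsto_approx_apply (t : ℝ≥0) {x : ℕ → X} {y : X} (h : Tendsto x atTop (𝓝 y)) :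
    Tendsto (fun n => R.approx n t (x n)) atTop (𝓝 (R.limit hd t y)) := by
  have h2 : Tendsto (fun n => R.approx n t (x n - y)) atTop (𝓝 0) :=
    squeeze_zero_norm (fun n => R.norm_approx_apply_le n t.coe_nonneg _)
      (by simpa using (h.sub_const y).norm)
  simpa using (R.tendsto_approx hd t y).add h2

/-- The Lipschitz bound in time is uniform in `n` on the domain and survives the limit; it yields
strong continuity. -/
theorem dist_limit_le {x y : X} (h : (x, y) ∈ A) (s t : ℝ≥0) :
    ‖R.limit hd t x - R.limit hd s x‖ ≤ ‖y‖ * ‖(t : ℝ) - s‖ := by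
  refine le_of_tendsto ((R.tendsto_approx hd t x).sub (R.tendsto_approx hd s x)).norm
    (Eventually.of_forall fun n => ?_)
  refine (R.norm_approx_sub_approx_le n s.coe_nonneg t.coe_nonneg x).trans ?_
  rw [R.yosida_apply h]
  gcongr
  exact R.norm_apply_le n y

theorem continuous_limit (x : X) : Continuous fun t => R.limit hd t x := by
  rw [Metric.continuous_iff]
  intro s ε hε
  obtain ⟨_, hyx, ⟨x', z⟩, hxz, rfl⟩ := Metric.dense_iff.1 hd x (ε / 3) (by positivity)
  rw [Metric.mem_ball, dist_eq_norm] at hyx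
  refine ⟨ε / 3 / (‖z‖ + 1), by positivity, fun t ht => ?_⟩
  have h1 := R.dist_limit_le hd hxz s t
  have h3 := R.norm_limit_le hd t (x' - x)
  have h4 := R.norm_limit_le hd s (x' - x)
  rw [map_sub] at h3 h4
  rw [NNReal.dist_eq, ← Real.norm_eq_abs, lt_div_iff₀ (by positivity)] at ht
  have e : R.limit hd t x - R.limit hd s x = (R.limit hd t x' - R.limit hd s x')
      - (R.limit hd t x' - R.limit hd t x) + (R.limit hd s x' - R.limit hd s x) := by abel
  rw [dist_eq_norm, e]
  refine ((norm_add_le _ _).trans (add_le_add_left (norm_sub_le _ _) _)).trans_lt ?_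
  dsimp only at hyx
  nlinarith [norm_nonneg ((t : ℝ) - s)]

/-- The semigroup with generator `A`. -/
def semigroup : ContractionSemigroup X where
  op := R.limit hd
  op_zero := by
    ext x
    refine tendsto_nhds_unique (R.tendsto_approx hd 0 x) ?_
    simp [approx]
  op_add s t := by
    ext x
    refine tendsto_nhds_unique (R.tendsto_approx hd (s + t) x) ?_
    refine (R.tendsto_approx_apply hd s (R.tendsto_approx hd t x)).congr fun n => ?_
    rw [NNReal.coe_add, approx_add]
    rfl
  contraction := R.norm_limit_le hd
  strongly_continuous := R.continuous_limit hd

/-- The integrated equation passes to the limit from the approximations by dominated convergence. It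
needs no derivative of the limit and places `A` inside the generator. -/
theorem semigroup_orbit_eq {x y : X} (h : (x, y) ∈ A) {t : ℝ} (ht : 0 ≤ t) :
    (R.semigroup hd).orbit x t = x + ∫ s in (0 : ℝ)..t, (R.semigroup hd).orbit y s := by
  have hcont : ∀ n (z : X), Continuous fun s => R.approx n s z := fun n z =>
    continuous_iff_continuousAt.2 fun s => (R.hasDerivAt_approx_apply n s z).continuousAt
  have h1 : ∀ n, R.approx n t x = x + ∫ s in (0 : ℝ)..t, R.approx n s (R.J n y) := by
    intro n
    rw [← R.yosida_apply h, intervalIntegral.integral_eq_sub_of_hasDerivAt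
      (fun s _ => R.hasDerivAt_approx_apply n s x) ((hcont n _).intervalIntegrable _ _)]
    simp [approx]
  have h2 : Tendsto (fun n => ∫ s in (0 : ℝ)..t, R.approx n s (R.J n y)) atTop
      (𝓝 (∫ s in (0 : ℝ)..t, (R.semigroup hd).orbit y s)) := by
    refine intervalIntegral.tendsto_integral_filter_of_dominated_convergence (fun _ => ‖y‖)
      (Eventually.of_forall fun n => (hcont n _).aestronglyMeasurable)
      (Eventually.of_forall fun n => Eventually.of_forall fun s hs => ?_)
      intervalIntegrable_const (Eventually.of_forall fun s hs => ?_)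
    · rw [uIoc_of_le ht] at hs
      exact (R.norm_approx_apply_le n hs.1.le _).trans (R.norm_apply_le n y)
    · rw [uIoc_of_le ht] at hs
      have := R.tendsto_approx_apply hd s.toNNReal (R.tendsto_J hd y)
      rwa [Real.coe_toNNReal _ hs.1.le] at this
  have h3 := R.tendsto_approx hd t.toNNReal x
  rw [Real.coe_toNNReal _ ht] at h3
  exact tendsto_nhds_unique h3 ((h2.const_add x).congr fun n => (h1 n).symm)

theorem generator_semigroup : (R.semigroup hd).generator = A := by
  refine (R.semigroup hd).generator_eq_of_subset (fun p hp => ?_) (R.θ_pos 0) fun f => ?_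
  · rw [ContractionSemigroup.mem_generator_iff]
    have := ((R.semigroup hd).hasDerivAt_integral_orbit p.2 0).const_add p.1
    rw [ContractionSemigroup.orbit_zero] at this
    exact this.hasDerivWithinAt.congr (fun s hs => R.semigroup_orbit_eq hd hp hs)
      (R.semigroup_orbit_eq hd hp le_rfl)
  · refine ⟨_, R.mem 0 f, ?_⟩
    rw [smul_smul, mul_inv_cancel₀ (R.θ_pos 0).ne', one_smul, sub_sub_cancel]

end ResolventSeq

/-! ### Mild solutions with a source constant in time -/

namespace ContractionSemigroup

variable {X : Type*} [NormedAddCommGroup X] [NormedSpace ℝ X] (τ : ContractionSemigroup X)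

/-- The mild solution of `v' = A v + F`, `v 0 = x`. -/
def mild (x F : X) (t : ℝ) : X := τ.orbit x t + ∫ s in (0 : ℝ)..t, τ.orbit F s

theorem mild_zero (x F : X) : τ.mild x F 0 = x := by simp [mild]

theorem mild_eq (x F : X) {t : ℝ} :
    τ.mild x F t = τ.op t.toNNReal x + ∫ s in (0 : ℝ)..t, τ.op (t - s).toNNReal F := by
  have := intervalIntegral.integral_comp_sub_left (a := 0) (b := t) (τ.orbit F) t
  rw [sub_self, sub_zero] at this
  rw [mild, ← this]
  rfl

variable [CompleteSpace X]

/-- `F` need not lie in the domain: the time integral of its orbit does, and `A` maps it to `τ(t) F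
- F`. -/
theorem mild_mem_generator {x y : X} (h : (x, y) ∈ τ.generator) (F : X) {t : ℝ} (ht : 0 ≤ t) :
    (τ.mild x F t, τ.orbit y t + (τ.orbit F t - F)) ∈ τ.generator :=
  τ.add_mem_generator (τ.orbit_mem_generator h ht) (τ.integral_orbit_mem_generator F ht)

theorem hasDerivWithinAt_mild {x y : X} (h : (x, y) ∈ τ.generator) (F : X) {t : ℝ} (ht : 0 ≤ t) :
    HasDerivWithinAt (τ.mild x F) (τ.orbit y t + τ.orbit F t) (Ici 0) t :=
  (τ.hasDerivWithinAt_orbit_Ici h ht).add (τ.hasDerivAt_integral_orbit F t).hasDerivWithinAt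

theorem contDiffOn_mild {x y : X} (h : (x, y) ∈ τ.generator) (F : X) :
    ContDiffOn ℝ 1 (τ.mild x F) (Ici 0) := by
  rw [contDiffOn_one_iff_derivWithin (uniqueDiffOn_Ici 0)]
  refine ⟨fun t ht => (τ.hasDerivWithinAt_mild h F ht).differentiableWithinAt, ?_⟩
  refine ((τ.continuous_orbit y).add (τ.continuous_orbit F)).continuousOn.congr fun t ht => ?_
  exact (τ.hasDerivWithinAt_mild h F ht).derivWithin (uniqueDiffOn_Ici 0 t ht)

end ContractionSemigroup

/-! ### Absolutely continuous functions on an interval -/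

/-- `F` is a primitive of the integrable function `f` on `[0, ℓ]`. -/
structure IsPrimitiveOn (ℓ : ℝ) (F f : ℝ → ℝ) : Prop where
  nonneg : 0 ≤ ℓ
  intervalIntegrable : IntervalIntegrable f volume 0 ℓ
  eq_add_integral : ∀ x ∈ Icc 0 ℓ, F x = F 0 + ∫ s in (0 : ℝ)..x, f s

namespace IsPrimitiveOn

variable {ℓ : ℝ} {F f H h : ℝ → ℝ}

theorem intervalIntegrable_left (hF : IsPrimitiveOn ℓ F f) {x : ℝ} (hx : x ∈ Icc 0 ℓ) :
    IntervalIntegrable f volume 0 x :=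
  hF.intervalIntegrable.mono_set (by
    rw [uIcc_of_le hx.1, uIcc_of_le (hx.1.trans hx.2)]; exact Icc_subset_Icc_right hx.2)

theorem continuousOn (hF : IsPrimitiveOn ℓ F f) : ContinuousOn F (Icc 0 ℓ) := by
  refine ContinuousOn.congr ?_ hF.eq_add_integral
  refine continuousOn_const.add ?_
  rw [← uIcc_of_le hF.nonneg]
  refine intervalIntegral.continuousOn_primitive_interval ?_
  rw [uIcc_of_le hF.nonneg, ← intervalIntegrable_iff_integrableOn_Icc_of_le hF.nonneg]
  exact hF.intervalIntegrable

theorem congr_left (hF : IsPrimitiveOn ℓ F f) (h : EqOn H F (Icc 0 ℓ)) : IsPrimitiveOn ℓ H f :=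
  ⟨hF.nonneg, hF.intervalIntegrable, fun x hx => by
    rw [h hx, h ⟨le_rfl, hx.1.trans hx.2⟩, hF.eq_add_integral x hx]⟩

theorem congr_right (hF : IsPrimitiveOn ℓ F f) (hfh : f =ᵐ[volume.restrict (Ioo 0 ℓ)] h) :
    IsPrimitiveOn ℓ F h := by
  have key : ∀ x ∈ Icc 0 ℓ, f =ᵐ[volume.restrict (uIoc 0 x)] h := fun x hx => by
    rw [uIoc_of_le hx.1, ← Measure.restrict_congr_set (Ioo_ae_eq_Ioc (μ := volume))]
    exact ae_restrict_of_ae_restrict_of_subset (Ioo_subset_Ioo_right hx.2) hfh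
  refine ⟨hF.nonneg, hF.intervalIntegrable.congr_ae (key ℓ ⟨hF.nonneg, le_rfl⟩), fun x hx => ?_⟩
  rw [hF.eq_add_integral x hx, intervalIntegral.integral_congr_ae_restrict (key x hx)]

theorem add (hF : IsPrimitiveOn ℓ F f) (hH : IsPrimitiveOn ℓ H h) :
    IsPrimitiveOn ℓ (fun x => F x + H x) (fun x => f x + h x) :=
  ⟨hF.nonneg, hF.intervalIntegrable.add hH.intervalIntegrable, fun x hx => by
    rw [hF.eq_add_integral x hx, hH.eq_add_integral x hx, intervalIntegral.integral_add
      (hF.intervalIntegrable_left hx) (hH.intervalIntegrable_left hx)]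
    ring⟩

theorem const_mul (c : ℝ) (hF : IsPrimitiveOn ℓ F f) :
    IsPrimitiveOn ℓ (fun x => c * F x) (fun x => c * f x) :=
  ⟨hF.nonneg, hF.intervalIntegrable.const_mul c, fun x hx => by
    rw [hF.eq_add_integral x hx, intervalIntegral.integral_const_mul]
    ring⟩

theorem sub (hF : IsPrimitiveOn ℓ F f) (hH : IsPrimitiveOn ℓ H h) :
    IsPrimitiveOn ℓ (fun x => F x - H x) (fun x => f x - h x) := by
  simpa [sub_eq_add_neg] using hF.add (hH.const_mul (-1))

/-- The product of two absolutely continuous functions. -/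
theorem mul (hF : IsPrimitiveOn ℓ F f) (hH : IsPrimitiveOn ℓ H h) :
    IsPrimitiveOn ℓ (fun x => F x * H x) (fun x => f x * H x + F x * h x) := by
  have hℓ := hF.nonneg
  refine ⟨hℓ, ?_, fun x hx => ?_⟩
  · have h1 := hF.continuousOn
    have h2 := hH.continuousOn
    rw [← uIcc_of_le hℓ] at h1 h2
    exact (hF.intervalIntegrable.mul_continuousOn h2).add
      (hH.intervalIntegrable.continuousOn_mul h1)
  -- The integral representations are absolutely continuous on `[0, x]` and agree there with the
  -- given functions, so integration by parts is applied to them.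
  · have hAC : ∀ {G g : ℝ → ℝ}, IsPrimitiveOn ℓ G g →
        AbsolutelyContinuousOnInterval (fun y => G 0 + ∫ s in (0 : ℝ)..y, g s) 0 x ∧
        ∀ᵐ y, y ∈ uIoc 0 x → deriv (fun y => G 0 + ∫ s in (0 : ℝ)..y, g s) y = g y := by
      intro G g hG
      have hg := hG.intervalIntegrable_left hx
      refine ⟨AbsolutelyContinuousOnInterval.add
        (contDiffOn_const (n := 1)).absolutelyContinuousOnInterval
        (hg.absolutelyContinuousOnInterval_intervalIntegral left_mem_uIcc), ?_⟩
      filter_upwards [hg.ae_hasDerivAt_integral] with y hy hy'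
      exact ((hy (uIoc_subset_uIcc hy') 0 left_mem_uIcc).const_add _).deriv
    have h1 := (hAC hF).1.integral_deriv_mul_eq_sub (hAC hH).1
    simp only [intervalIntegral.integral_same, add_zero] at h1
    rw [← hF.eq_add_integral x hx, ← hH.eq_add_integral x hx] at h1
    rw [← sub_eq_iff_eq_add', ← h1]
    refine intervalIntegral.integral_congr_ae ?_
    filter_upwards [(hAC hF).2, (hAC hH).2] with y h2 h3 hy
    have hy' : y ∈ Icc 0 ℓ := by
      rw [uIoc_of_le hx.1] at hy
      exact ⟨hy.1.le, hy.2.trans hx.2⟩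
    rw [h2 hy, h3 hy, ← hF.eq_add_integral y hy', ← hH.eq_add_integral y hy']

theorem of_hasDerivAt (hℓ : 0 ≤ ℓ) (hc : ContinuousOn F (Icc 0 ℓ))
    (hd : ∀ x ∈ Ioo 0 ℓ, HasDerivAt F (f x) x) (hf : IntervalIntegrable f volume 0 ℓ) :
    IsPrimitiveOn ℓ F f := by
  refine ⟨hℓ, hf, fun x hx => ?_⟩
  rw [intervalIntegral.integral_eq_sub_of_hasDerivAt_of_le hx.1
    (hc.mono (Icc_subset_Icc_right hx.2)) (fun y hy => hd y ⟨hy.1, hy.2.trans_le hx.2⟩)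
    (hf.mono_set (by
      rw [uIcc_of_le hx.1, uIcc_of_le (hx.1.trans hx.2)]; exact Icc_subset_Icc_right hx.2))]
  ring

theorem hasDerivAt (hF : IsPrimitiveOn ℓ F f) (hf : ContinuousOn f (Icc 0 ℓ)) {x : ℝ}
    (hx : x ∈ Ioo 0 ℓ) : HasDerivAt F (f x) x := by
  have hn : Icc 0 ℓ ∈ 𝓝 x := Icc_mem_nhds hx.1 hx.2
  have h1 : HasDerivAt (fun y => F 0 + ∫ s in (0 : ℝ)..y, f s) (f x) x := by
    refine (intervalIntegral.integral_hasDerivAt_right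
      (hF.intervalIntegrable_left (Ioo_subset_Icc_self hx)) ?_ (hf.continuousAt hn)).const_add _
    exact ⟨Icc 0 ℓ, hn, hf.aestronglyMeasurable measurableSet_Icc⟩
  exact h1.congr_of_eventuallyEq (Filter.mem_of_superset hn fun y hy => hF.eq_add_integral y hy)

/-- The composition of a `C¹` function with a function with a continuous derivative. -/
theorem comp {S S' : ℝ → ℝ} (hF : IsPrimitiveOn ℓ F f) (hf : ContinuousOn f (Icc 0 ℓ))
    (hS : ∀ y, HasDerivAt S (S' y) y) (hS' : Continuous S') :
    IsPrimitiveOn ℓ (fun x => S (F x)) (fun x => S' (F x) * f x) := by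
  have hSc : Continuous S := continuous_iff_continuousAt.2 fun y => (hS y).continuousAt
  refine of_hasDerivAt hF.nonneg (hSc.comp_continuousOn hF.continuousOn)
    (fun x hx => (hS (F x)).comp x (hF.hasDerivAt hf hx)) ?_
  rw [intervalIntegrable_iff_integrableOn_Icc_of_le hF.nonneg]
  exact ((hS'.comp_continuousOn hF.continuousOn).mul hf).integrableOn_Icc

theorem integral_eq (hF : IsPrimitiveOn ℓ F f) : ∫ s in (0 : ℝ)..ℓ, f s = F ℓ - F 0 := by
  rw [hF.eq_add_integral ℓ ⟨hF.nonneg, le_rfl⟩]; ring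

theorem sub_eq (hF : IsPrimitiveOn ℓ F f) {x y : ℝ} (hx : x ∈ Icc 0 ℓ) (hy : y ∈ Icc 0 ℓ) :
    F y - F x = ∫ s in x..y, f s := by
  rw [hF.eq_add_integral x hx, hF.eq_add_integral y hy, add_sub_add_left_eq_sub,
    intervalIntegral.integral_interval_sub_left (hF.intervalIntegrable_left hy)
      (hF.intervalIntegrable_left hx)]

end IsPrimitiveOn

/-! ### Weak derivatives on an interval -/

section WeakDeriv

variable {ℓ : ℝ}

theorem intervalIntegrable_coeFn (hℓ : 0 ≤ ℓ) (f : L1Arc ℓ) : IntervalIntegrable f volume 0 ℓ := by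
  rw [intervalIntegrable_iff_integrableOn_Ioo_of_le hℓ]
  exact L1.integrable_coeFn f

theorem setIntegral_Ioo_eq (hℓ : 0 ≤ ℓ) (f : ℝ → ℝ) :
    ∫ x in Ioo 0 ℓ, f x = ∫ x in (0 : ℝ)..ℓ, f x := by
  rw [intervalIntegral.integral_of_le hℓ, integral_Ioc_eq_integral_Ioo]

theorem IsPrimitiveOn.of_contDiff (hℓ : 0 ≤ ℓ) {φ : ℝ → ℝ} (hφ : ContDiff ℝ 1 φ) :
    IsPrimitiveOn ℓ φ (deriv φ) :=
  .of_hasDerivAt hℓ hφ.continuous.continuousOn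
    (fun x _ => (hφ.differentiable one_ne_zero x).hasDerivAt)
    ((hφ.continuous_deriv le_rfl).intervalIntegrable _ _)

/-- The primitive of a function with a test function. -/
theorem IsPrimitiveOn.integral_mul_deriv {F f φ : ℝ → ℝ} (hF : IsPrimitiveOn ℓ F f)
    (hφ : ContDiff ℝ 1 φ) (hs : tsupport φ ⊆ Ioo 0 ℓ) :
    ∫ x in (0 : ℝ)..ℓ, F x * deriv φ x = - ∫ x in (0 : ℝ)..ℓ, f x * φ x := by
  have hℓ := hF.nonneg
  have h := (hF.mul (.of_contDiff hℓ hφ)).integral_eq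
  have h0 : φ 0 = 0 := image_eq_zero_of_notMem_tsupport fun h => lt_irrefl _ (hs h).1
  have h1 : φ ℓ = 0 := image_eq_zero_of_notMem_tsupport fun h => lt_irrefl _ (hs h).2
  have hc := hF.continuousOn
  rw [← uIcc_of_le hℓ] at hc
  rw [intervalIntegral.integral_add
    (hF.intervalIntegrable.mul_continuousOn hφ.continuous.continuousOn)
    (((hφ.continuous_deriv le_rfl).intervalIntegrable _ _).continuousOn_mul hc),
    h0, h1, mul_zero, mul_zero, sub_zero] at h
  linarith

theorem isWeakDeriv_of_isPrimitiveOn {f g : L1Arc ℓ} {F G : ℝ → ℝ} (h : IsPrimitiveOn ℓ F G)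
    (hF : f =ᵐ[volume.restrict (Ioo 0 ℓ)] F) (hG : g =ᵐ[volume.restrict (Ioo 0 ℓ)] G) :
    IsWeakDeriv f g := by
  intro φ h1 _ h3
  have e1 : ∫ x in Ioo 0 ℓ, f x * deriv φ x = ∫ x in Ioo 0 ℓ, F x * deriv φ x := by
    refine integral_congr_ae ?_
    filter_upwards [hF] with x hx
    rw [hx]
  have e2 : ∫ x in Ioo 0 ℓ, g x * φ x = ∫ x in Ioo 0 ℓ, G x * φ x := by
    refine integral_congr_ae ?_
    filter_upwards [hG] with x hx
    rw [hx]
  rw [e1, e2, setIntegral_Ioo_eq h.nonneg, setIntegral_Ioo_eq h.nonneg]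
  exact h.integral_mul_deriv (h1.of_le (by exact_mod_cast le_top)) h3

theorem exists_test_integral_eq_one (hℓ : 0 < ℓ) : ∃ ρ : ℝ → ℝ, ContDiff ℝ ∞ ρ ∧
    HasCompactSupport ρ ∧ tsupport ρ ⊆ Ioo 0 ℓ ∧ ∫ x, ρ x = 1 ∧ ∀ x, 0 ≤ ρ x := by
  let b : ContDiffBump (ℓ / 2) := ⟨ℓ / 8, ℓ / 4, by positivity, by linarith⟩
  refine ⟨b.normed volume, b.contDiff_normed, b.hasCompactSupport_normed, ?_, b.integral_normed,
    b.nonneg_normed⟩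
  rw [b.tsupport_normed_eq]
  intro x hx
  rw [Metric.mem_closedBall, Real.dist_eq, abs_le] at hx
  change -(ℓ / 4) ≤ _ ∧ _ ≤ ℓ / 4 at hx
  constructor <;> linarith [hx.1, hx.2]

/-- A test function with vanishing integral is the derivative of a test function. -/
theorem exists_test_deriv_eq {ψ : ℝ → ℝ} (h1 : ContDiff ℝ ∞ ψ) (h2 : HasCompactSupport ψ)
    (h3 : tsupport ψ ⊆ Ioo 0 ℓ) (h4 : ∫ x, ψ x = 0) : ∃ φ : ℝ → ℝ, ContDiff ℝ ∞ φ ∧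
    HasCompactSupport φ ∧ tsupport φ ⊆ Ioo 0 ℓ ∧ deriv φ = ψ := by
  -- The primitive based at `a` vanishes to the left of `[a, b]` trivially and to the right because
  -- the total integral is zero. If the support is empty, any `a > 0` and `b < ℓ` serve.
  obtain ⟨a, b, ha, hb, hab⟩ : ∃ a b : ℝ, 0 < a ∧ b < ℓ ∧ tsupport ψ ⊆ Icc a b := by
    rcases (tsupport ψ).eq_empty_or_nonempty with he | hne
    · exact ⟨1, ℓ - 1, one_pos, by linarith, by rw [he]; exact empty_subset _⟩
    · exact ⟨sInf (tsupport ψ), sSup (tsupport ψ), (h3 (h2.isCompact.sInf_mem hne)).1,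
        (h3 (h2.isCompact.sSup_mem hne)).2,
        subset_Icc_csInf_csSup h2.isCompact.bddBelow h2.isCompact.bddAbove⟩
  have hz : ∀ x ∉ Icc a b, ψ x = 0 := fun x hx =>
    image_eq_zero_of_notMem_tsupport fun h => hx (hab h)
  have hi : ∀ x y, IntervalIntegrable ψ volume x y := fun x y =>
    h1.continuous.intervalIntegrable x y
  have hd : ∀ x, HasDerivAt (fun x => ∫ s in a..x, ψ s) (ψ x) x := fun x =>
    intervalIntegral.integral_hasDerivAt_right (hi _ _)
      (h1.continuous.stronglyMeasurableAtFilter _ _) h1.continuous.continuousAt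
  have hderiv : deriv (fun x => ∫ s in a..x, ψ s) = ψ := funext fun x => (hd x).deriv
  have hsupp : ∀ x ∉ Icc a b, ∫ s in a..x, ψ s = 0 := by
    intro x hx
    rcases lt_or_ge x a with hxa | hxa
    · rw [intervalIntegral.integral_symm, intervalIntegral.integral_of_le hxa.le,
        integral_Ioc_eq_integral_Ioo, setIntegral_eq_zero_of_forall_eq_zero, neg_zero]
      exact fun y hy => hz y fun h => absurd h.1 (not_le.2 hy.2)
    · have hxb : b < x := lt_of_not_ge fun h => hx ⟨hxa, h⟩
      rw [intervalIntegral.integral_of_le hxa, ← integral_Icc_eq_integral_Ioc,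
        setIntegral_eq_integral_of_forall_compl_eq_zero, h4]
      exact fun y hy => hz y fun h => hy ⟨h.1, h.2.trans hxb.le⟩
  have hts : tsupport (fun x => ∫ s in a..x, ψ s) ⊆ Icc a b :=
    closure_minimal (fun x hx => by_contra fun h => hx (hsupp x h)) isClosed_Icc
  refine ⟨fun x => ∫ s in a..x, ψ s, ?_, ?_, hts.trans fun x hx => ⟨ha.trans_le hx.1,
    hx.2.trans_lt hb⟩, hderiv⟩
  · rw [contDiff_infty_iff_deriv, hderiv]
    exact ⟨fun x => (hd x).differentiableAt, h1⟩
  · exact HasCompactSupport.of_support_subset_isCompact isCompact_Icc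
      ((subset_tsupport _).trans hts)

/-- The du Bois-Reymond lemma. -/
theorem ae_eq_const_of_integral_mul_deriv_eq_zero (hℓ : 0 < ℓ) {D : ℝ → ℝ}
    (hD : IntegrableOn D (Ioo 0 ℓ)) (h : ∀ φ : ℝ → ℝ, ContDiff ℝ ∞ φ → HasCompactSupport φ →
      tsupport φ ⊆ Ioo 0 ℓ → ∫ x in Ioo 0 ℓ, D x * deriv φ x = 0) :
    ∃ c : ℝ, D =ᵐ[volume.restrict (Ioo 0 ℓ)] fun _ => c := by
  obtain ⟨ρ, r1, r2, r3, r4, -⟩ := exists_test_integral_eq_one hℓ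
  have hmul : ∀ {E ψ : ℝ → ℝ}, IntegrableOn E (Ioo 0 ℓ) → ContDiff ℝ ∞ ψ → HasCompactSupport ψ →
      IntegrableOn (fun x => E x * ψ x) (Ioo 0 ℓ) := fun hE h1 h2 => by
    obtain ⟨C, hC⟩ := h1.continuous.bounded_above_of_compact_support h2
    exact hE.mul_bdd h1.continuous.aestronglyMeasurable (Eventually.of_forall hC)
  -- The constant is the `ρ`-mean of `D`: for a test function `ψ`, the function `ψ - (∫ ψ) ρ` has
  -- zero integral, so it is the derivative of a test function, whence `∫ D ψ = c ∫ ψ`.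
  set c := ∫ x in Ioo 0 ℓ, D x * ρ x with hc
  have hE : IntegrableOn (fun x => D x - c) (Ioo 0 ℓ) := hD.sub (integrable_const c)
  refine ⟨c, ?_⟩
  have key := isOpen_Ioo.ae_eq_zero_of_integral_contDiff_smul_eq_zero (U := Ioo 0 ℓ) (μ := volume)
    hE.locallyIntegrableOn fun ψ h1 h2 h3 => by
      set m := ∫ x, ψ x with hm
      have hmψ : ∫ x in Ioo 0 ℓ, ψ x = m :=
        setIntegral_eq_integral_of_forall_compl_eq_zero fun x hx =>
          image_eq_zero_of_notMem_tsupport fun h => hx (h3 h)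
      have hρψ : ContDiff ℝ ∞ (fun x => ψ x - m * ρ x) := h1.sub (contDiff_const.mul r1)
      have hsub : tsupport (fun x => ψ x - m * ρ x) ⊆ Ioo 0 ℓ := by
        refine (closure_minimal (t := tsupport ψ ∪ tsupport ρ) (fun x hx => ?_)
          ((isClosed_tsupport _).union (isClosed_tsupport _))).trans (union_subset h3 r3)
        by_contra hn
        rw [mem_union, not_or] at hn
        refine hx ?_
        simp [image_eq_zero_of_notMem_tsupport hn.1, image_eq_zero_of_notMem_tsupport hn.2]
      have hint : ∫ x, (ψ x - m * ρ x) = 0 := by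
        rw [integral_sub (h1.continuous.integrable_of_hasCompactSupport h2)
          ((r1.continuous.integrable_of_hasCompactSupport r2).const_mul m), integral_const_mul, r4,
          mul_one, sub_self]
      obtain ⟨φ, p1, p2, p3, p4⟩ := exists_test_deriv_eq hρψ (h2.sub r2.mul_left) hsub hint
      have h4 := h φ p1 p2 p3
      rw [p4] at h4
      have e : ∀ x, D x * (ψ x - m * ρ x) = D x * ψ x - m * (D x * ρ x) := fun x => by ring
      simp only [e] at h4
      rw [integral_sub (hmul hD h1 h2) ((hmul hD r1 r2).const_mul m), integral_const_mul,
        ← hc] at h4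
      have hsupp : ∫ x, ψ x • (D x - c) = ∫ x in Ioo 0 ℓ, ψ x • (D x - c) :=
        (setIntegral_eq_integral_of_forall_compl_eq_zero fun x hx => by
          rw [image_eq_zero_of_notMem_tsupport fun h => hx (h3 h), zero_smul]).symm
      rw [hsupp]
      have e2 : ∀ x, ψ x • (D x - c) = D x * ψ x - c * ψ x := fun x => by
        rw [smul_eq_mul]; ring
      simp only [e2]
      rw [integral_sub (hmul hD h1 h2)
        ((h1.continuous.integrable_of_hasCompactSupport h2).integrableOn.const_mul c),
        integral_const_mul, hmψ]
      linarith
  rw [EventuallyEq, ae_restrict_iff' measurableSet_Ioo]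
  filter_upwards [key] with x hx hx'
  exact sub_eq_zero.1 (hx hx')

theorem isPrimitiveOn_integral (hℓ : 0 ≤ ℓ) (g : L1Arc ℓ) (c : ℝ) :
    IsPrimitiveOn ℓ (fun x => c + ∫ s in (0 : ℝ)..x, g s) g :=
  ⟨hℓ, intervalIntegrable_coeFn hℓ g, fun x _ => by simp⟩

theorem trace_ae_eq (hℓ : 0 < ℓ) {f : L1Arc ℓ} {F : ℝ → ℝ} (hF : ContinuousOn F (Icc 0 ℓ))
    (hfF : f =ᵐ[volume.restrict (Ioo 0 ℓ)] F) : f =ᵐ[volume.restrict (Ioo 0 ℓ)] trace f := by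
  filter_upwards [hfF, ae_restrict_mem measurableSet_Ioo] with x hx hx'
  rw [hx, trace_eq hℓ hF hfF (Ioo_subset_Icc_self hx')]

/-- Subtracting a primitive of `g` from `f` leaves a function with vanishing weak derivative, which
is constant by du Bois-Reymond. -/
theorem IsWeakDeriv.exists_isPrimitiveOn (hℓ : 0 < ℓ) {f g : L1Arc ℓ} (h : IsWeakDeriv f g) :
    ∃ F : ℝ → ℝ, IsPrimitiveOn ℓ F g ∧ f =ᵐ[volume.restrict (Ioo 0 ℓ)] F := by
  have hP := isPrimitiveOn_integral hℓ.le g 0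
  have hPi : IntegrableOn (fun x => 0 + ∫ s in (0 : ℝ)..x, g s) (Ioo 0 ℓ) :=
    hP.continuousOn.integrableOn_Icc.mono_set Ioo_subset_Icc_self
  obtain ⟨c, hc⟩ := ae_eq_const_of_integral_mul_deriv_eq_zero hℓ
    (D := fun x => f x - (0 + ∫ s in (0 : ℝ)..x, g s)) ((L1.integrable_coeFn f).sub hPi)
    fun φ h1 h2 h3 => by
      obtain ⟨C, hC⟩ := (h1.continuous_deriv (by simp)).bounded_above_of_compact_support h2.deriv
      have hb := (h1.continuous_deriv (by simp)).aestronglyMeasurable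
        (μ := volume.restrict (Ioo 0 ℓ))
      simp only [sub_mul]
      rw [integral_sub ((L1.integrable_coeFn f).mul_bdd hb (Eventually.of_forall hC))
        (hPi.mul_bdd hb (Eventually.of_forall hC)), h φ h1 h2 h3,
        setIntegral_Ioo_eq hℓ.le (fun x => (0 + ∫ s in (0 : ℝ)..x, g s) * deriv φ x),
        hP.integral_mul_deriv (h1.of_le (by exact_mod_cast le_top)) h3, setIntegral_Ioo_eq hℓ.le,
        sub_self]
  refine ⟨_, isPrimitiveOn_integral hℓ.le g c, ?_⟩
  filter_upwards [hc] with x hx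
  rw [← hx]; ring

theorem IsWeakDeriv.isPrimitiveOn_trace (hℓ : 0 < ℓ) {f g : L1Arc ℓ} (h : IsWeakDeriv f g) :
    IsPrimitiveOn ℓ (trace f) g := by
  obtain ⟨F, hF, hfF⟩ := h.exists_isPrimitiveOn hℓ
  exact hF.congr_left fun x hx => trace_eq hℓ hF.continuousOn hfF hx

theorem IsWeakDeriv.ae_eq_trace (hℓ : 0 < ℓ) {f g : L1Arc ℓ} (h : IsWeakDeriv f g) :
    f =ᵐ[volume.restrict (Ioo 0 ℓ)] trace f := by
  obtain ⟨F, hF, hfF⟩ := h.exists_isPrimitiveOn hℓ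
  exact trace_ae_eq hℓ hF.continuousOn hfF

theorem IsWeakDeriv.trace_add (hℓ : 0 < ℓ) {f g f' g' : L1Arc ℓ} (h : IsWeakDeriv f g)
    (h' : IsWeakDeriv f' g') {x : ℝ} (hx : x ∈ Icc 0 ℓ) :
    trace (f + f') x = trace f x + trace f' x := by
  refine trace_eq hℓ (g := fun x => trace f x + trace f' x)
    ((h.isPrimitiveOn_trace hℓ).continuousOn.add (h'.isPrimitiveOn_trace hℓ).continuousOn) ?_ hx
  filter_upwards [h.ae_eq_trace hℓ, h'.ae_eq_trace hℓ, Lp.coeFn_add f f'] with x h1 h2 h3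
  rw [h3, Pi.add_apply, h1, h2]

theorem IsWeakDeriv.trace_smul (hℓ : 0 < ℓ) (c : ℝ) {f g : L1Arc ℓ} (h : IsWeakDeriv f g)
    {x : ℝ} (hx : x ∈ Icc 0 ℓ) : trace (c • f) x = c * trace f x := by
  refine trace_eq hℓ (g := fun x => c * trace f x)
    (continuousOn_const.mul (h.isPrimitiveOn_trace hℓ).continuousOn) ?_ hx
  filter_upwards [h.ae_eq_trace hℓ, Lp.coeFn_smul c f] with x h1 h3
  rw [h3, Pi.smul_apply, h1, smul_eq_mul]

/-- Weak derivatives are unique. -/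
theorem IsWeakDeriv.unique {f g g' : L1Arc ℓ} (h : IsWeakDeriv f g) (h' : IsWeakDeriv f g') :
    g = g' := by
  refine Lp.ext ?_
  rw [EventuallyEq, ae_restrict_iff' measurableSet_Ioo]
  have hi : IntegrableOn (fun x => g x - g' x) (Ioo 0 ℓ) :=
    (L1.integrable_coeFn g).sub (L1.integrable_coeFn g')
  have key := isOpen_Ioo.ae_eq_zero_of_integral_contDiff_smul_eq_zero (U := Ioo 0 ℓ) (μ := volume)
    hi.locallyIntegrableOn fun ψ h1 h2 h3 => by
      have hsupp : ∫ x, ψ x • (g x - g' x) = ∫ x in Ioo 0 ℓ, ψ x • (g x - g' x) :=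
        (setIntegral_eq_integral_of_forall_compl_eq_zero fun x hx => by
          rw [image_eq_zero_of_notMem_tsupport fun h => hx (h3 h), zero_smul]).symm
      have e2 : ∀ x, ψ x • (g x - g' x) = g x * ψ x - g' x * ψ x := fun x => by
        rw [smul_eq_mul]; ring
      rw [hsupp]
      simp only [e2]
      rw [integral_sub (integrable_mul_test g h1.continuous h2)
        (integrable_mul_test g' h1.continuous h2), sub_eq_zero, ← neg_inj, ← h ψ h1 h2 h3,
        ← h' ψ h1 h2 h3]
  filter_upwards [key] with x hx hx'
  exact sub_eq_zero.1 (hx hx')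

end WeakDeriv

/-! ### The space `W^{2,1}` of one arc -/

section Arc

variable {ℓ : ℝ}

theorem norm_L1Arc_eq (hℓ : 0 ≤ ℓ) (f : L1Arc ℓ) : ‖f‖ = ∫ x in (0 : ℝ)..ℓ, |f x| := by
  rw [L1.norm_eq_integral_norm, ← setIntegral_Ioo_eq hℓ]
  rfl

theorem intervalIntegral_congr_Ioo (hℓ : 0 ≤ ℓ) {f g : ℝ → ℝ}
    (h : f =ᵐ[volume.restrict (Ioo 0 ℓ)] g) :
    ∫ x in (0 : ℝ)..ℓ, f x = ∫ x in (0 : ℝ)..ℓ, g x := by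
  rw [← setIntegral_Ioo_eq hℓ, ← setIntegral_Ioo_eq hℓ]
  exact integral_congr_ae h

theorem W21Arc.isPrimitiveOn_zero (hℓ : 0 < ℓ) (w : W21Arc ℓ) :
    IsPrimitiveOn ℓ (trace (w.1 0)) (trace (w.1 1)) :=
  (w.2.1.isPrimitiveOn_trace hℓ).congr_right (w.2.2.ae_eq_trace hℓ)

theorem W21Arc.isPrimitiveOn_one (hℓ : 0 < ℓ) (w : W21Arc ℓ) :
    IsPrimitiveOn ℓ (trace (w.1 1)) (w.1 2) :=
  w.2.2.isPrimitiveOn_trace hℓ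

theorem W21Arc.ext_zero {w v : W21Arc ℓ} (h : w.1 0 = v.1 0) : w = v := by
  have h1 : w.1 1 = v.1 1 := w.2.1.unique (h ▸ v.2.1)
  have h2 : w.1 2 = v.1 2 := w.2.2.unique (h1 ▸ v.2.2)
  refine Subtype.ext (PiLp.ext fun k => ?_)
  fin_cases k
  exacts [h, h1, h2]

theorem W21Arc.norm_eq (w : W21Arc ℓ) : ‖w‖ = ‖w.1 0‖ + ‖w.1 1‖ + ‖w.1 2‖ := by
  rw [Submodule.coe_norm, PiLp.norm_eq_of_L1, Fin.sum_univ_three]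

/-- The way back from pointwise functions to `W^{2,1}`, used for resolvent solutions, cut-off
approximations and lifts. -/
theorem exists_W21Arc_of_isPrimitiveOn (hℓ : 0 < ℓ) {F₀ F₁ F₂ : ℝ → ℝ}
    (h₀ : IsPrimitiveOn ℓ F₀ F₁) (h₁ : IsPrimitiveOn ℓ F₁ F₂) :
    ∃ w : W21Arc ℓ, w.1 0 =ᵐ[volume.restrict (Ioo 0 ℓ)] F₀ ∧
      w.1 1 =ᵐ[volume.restrict (Ioo 0 ℓ)] F₁ ∧ w.1 2 =ᵐ[volume.restrict (Ioo 0 ℓ)] F₂ ∧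
      (∀ x ∈ Icc 0 ℓ, trace (w.1 0) x = F₀ x) ∧ ∀ x ∈ Icc 0 ℓ, trace (w.1 1) x = F₁ x := by
  have i0 : Integrable F₀ (volume.restrict (Ioo 0 ℓ)) :=
    h₀.continuousOn.integrableOn_Icc.mono_set Ioo_subset_Icc_self
  have i1 : Integrable F₁ (volume.restrict (Ioo 0 ℓ)) :=
    h₁.continuousOn.integrableOn_Icc.mono_set Ioo_subset_Icc_self
  have i2 : Integrable F₂ (volume.restrict (Ioo 0 ℓ)) :=
    (intervalIntegrable_iff_integrableOn_Ioo_of_le hℓ.le).1 h₁.intervalIntegrable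
  have e0 := i0.coeFn_toL1
  have e1 := i1.coeFn_toL1
  have e2 := i2.coeFn_toL1
  let w : W21Arc ℓ := ⟨WithLp.toLp 1 ![i0.toL1 F₀, i1.toL1 F₁, i2.toL1 F₂],
    isWeakDeriv_of_isPrimitiveOn h₀ e0 e1, isWeakDeriv_of_isPrimitiveOn h₁ e1 e2⟩
  exact ⟨w, e0, e1, e2, fun x hx => trace_eq hℓ h₀.continuousOn e0 hx,
    fun x hx => trace_eq hℓ h₁.continuousOn e1 hx⟩

theorem isPrimitiveOn_derivWithin (hℓ : 0 < ℓ) {q : ℝ → ℝ} (hq : ContDiffOn ℝ 1 q (Icc 0 ℓ)) :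
    IsPrimitiveOn ℓ q (derivWithin q (Icc 0 ℓ)) := by
  have hu := uniqueDiffOn_Icc hℓ
  refine .of_hasDerivAt hℓ.le hq.continuousOn (fun x hx => ?_) ?_
  · exact ((hq.differentiableOn one_ne_zero x
      (Ioo_subset_Icc_self hx)).hasDerivWithinAt).hasDerivAt (Icc_mem_nhds hx.1 hx.2)
  · rw [intervalIntegrable_iff_integrableOn_Icc_of_le hℓ.le]
    exact (hq.continuousOn_derivWithin hu le_rfl).integrableOn_Icc

theorem isPrimitiveOn_iteratedDerivWithin_two (hℓ : 0 < ℓ) {q : ℝ → ℝ}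
    (hq : ContDiffOn ℝ 2 q (Icc 0 ℓ)) :
    IsPrimitiveOn ℓ (derivWithin q (Icc 0 ℓ)) (iteratedDerivWithin 2 q (Icc 0 ℓ)) := by
  have e : iteratedDerivWithin 2 q (Icc 0 ℓ)
      = derivWithin (derivWithin q (Icc 0 ℓ)) (Icc 0 ℓ) := by
    rw [iteratedDerivWithin_succ', iteratedDerivWithin_one]
  rw [e]
  exact isPrimitiveOn_derivWithin hℓ
    (hq.derivWithin (uniqueDiffOn_Icc hℓ) (by norm_num [one_add_one_eq_two]))

/-! ### The regularised sign function -/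

/-- A smooth approximation of the sign function. -/
def smoothSign (δ y : ℝ) : ℝ := y / √(y ^ 2 + δ ^ 2)

theorem smoothSign_zero (δ : ℝ) : smoothSign δ 0 = 0 := zero_div _

theorem sqrt_sq_add_sq_pos {δ : ℝ} (hδ : 0 < δ) (y : ℝ) : 0 < √(y ^ 2 + δ ^ 2) :=
  Real.sqrt_pos.2 (by positivity)

theorem hasDerivAt_sqrt_sq_add_sq {δ : ℝ} (hδ : 0 < δ) (y : ℝ) :
    HasDerivAt (fun y => √(y ^ 2 + δ ^ 2)) (y / √(y ^ 2 + δ ^ 2)) y := by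
  have h : HasDerivAt (fun y => y ^ 2 + δ ^ 2) (2 * y) y := by
    simpa using (hasDerivAt_pow 2 y).add_const (δ ^ 2)
  exact (h.sqrt (by positivity)).congr_deriv (mul_div_mul_left _ _ two_ne_zero)

theorem hasDerivAt_smoothSign {δ : ℝ} (hδ : 0 < δ) (y : ℝ) :
    HasDerivAt (smoothSign δ) (δ ^ 2 / √(y ^ 2 + δ ^ 2) ^ 3) y := by
  have hr := sqrt_sq_add_sq_pos hδ y
  have h := (hasDerivAt_id' y).fun_div (hasDerivAt_sqrt_sq_add_sq hδ y) hr.ne'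
  refine h.congr_deriv ?_
  have h2 := Real.sq_sqrt (show 0 ≤ y ^ 2 + δ ^ 2 by positivity)
  field_simp
  linarith

theorem monotone_smoothSign {δ : ℝ} (hδ : 0 < δ) : Monotone (smoothSign δ) :=
  monotone_of_hasDerivAt_nonneg (hasDerivAt_smoothSign hδ) fun y => by
    have := sqrt_sq_add_sq_pos hδ y
    simp only [Pi.zero_apply]
    positivity

theorem abs_smoothSign_le {δ : ℝ} (hδ : 0 < δ) (y : ℝ) : |smoothSign δ y| ≤ 1 := by
  have hr := sqrt_sq_add_sq_pos hδ y
  rw [smoothSign, abs_div, abs_of_pos hr, div_le_one hr]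
  exact Real.abs_le_sqrt (by nlinarith)

theorem abs_le_mul_smoothSign_add {δ : ℝ} (hδ : 0 < δ) (y : ℝ) : |y| ≤ y * smoothSign δ y + δ := by
  have hr := sqrt_sq_add_sq_pos hδ y
  have h2 := Real.sq_sqrt (show 0 ≤ y ^ 2 + δ ^ 2 by positivity)
  have h3 : |y| ≤ √(y ^ 2 + δ ^ 2) := Real.abs_le_sqrt (by nlinarith)
  have h4 : √(y ^ 2 + δ ^ 2) ≤ |y| + δ := by
    rw [Real.sqrt_le_left (by positivity)]
    nlinarith [sq_abs y, abs_nonneg y]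
  rw [smoothSign, ← sub_le_iff_le_add, mul_div_assoc', le_div_iff₀ hr]
  generalize √(y ^ 2 + δ ^ 2) = s at *
  -- The claim is now `(|y| - δ) s ≤ y²`: its left side is nonpositive if `|y| ≤ δ`, and otherwise
  -- `s ≤ |y| + δ` bounds it by `y² - δ²`.
  rcases le_total |y| δ with h | h
  · nlinarith [mul_nonneg (sub_nonneg.2 h) hr.le, mul_self_nonneg y]
  · have h5 := mul_le_mul_of_nonneg_left h4 (sub_nonneg.2 h)
    nlinarith [sq_abs y]

/-- The function `y S'(y)`, with `S` the smooth sign, has a primitive with values in `[-δ, 0]`; this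
makes the convection term negligible as `δ → 0`. -/
theorem hasDerivAt_neg_sq_div_sqrt {δ : ℝ} (hδ : 0 < δ) (y : ℝ) :
    HasDerivAt (fun y => -(δ ^ 2 / √(y ^ 2 + δ ^ 2))) (y * (δ ^ 2 / √(y ^ 2 + δ ^ 2) ^ 3)) y := by
  have hr := sqrt_sq_add_sq_pos hδ y
  have h := ((hasDerivAt_const y (δ ^ 2)).fun_div (hasDerivAt_sqrt_sq_add_sq hδ y) hr.ne').fun_neg
  refine h.congr_deriv ?_
  field_simp
  ring

/-- The differential inequality behind dissipativity, on one arc. -/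
theorem integral_mul_smoothSign_le {ε lam δ : ℝ} (hε : 0 < ε) (hlam : 0 < lam)
    (hδ : 0 < δ) {W W₁ W₂ : ℝ → ℝ} (hW : IsPrimitiveOn ℓ W W₁) (hW₁ : IsPrimitiveOn ℓ W₁ W₂) :
    ∫ x in (0 : ℝ)..ℓ, (ε * W₂ x - lam * W₁ x) * smoothSign δ (W x)
      ≤ (ε * W₁ ℓ - lam * W ℓ) * smoothSign δ (W ℓ) - (ε * W₁ 0 - lam * W 0) * smoothSign δ (W 0)
        + lam * δ := by
  have hℓ := hW.nonneg
  have hc₁ := hW₁.continuousOn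
  have hsc : Continuous fun y : ℝ => √(y ^ 2 + δ ^ 2) := by fun_prop
  have hSc : Continuous fun y : ℝ => δ ^ 2 / √(y ^ 2 + δ ^ 2) ^ 3 :=
    continuous_const.div (hsc.pow 3) fun y => (pow_pos (sqrt_sq_add_sq_pos hδ y) 3).ne'
  have hz := (hW₁.const_mul ε).sub (hW.const_mul lam)
  have hS := hW.comp hc₁ (hasDerivAt_smoothSign hδ) hSc
  have hT := hW.comp hc₁ (hasDerivAt_neg_sq_div_sqrt hδ) (continuous_id.mul hSc)
  have h1 := (hz.mul hS).integral_eq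
  have h2 := hT.integral_eq
  have hic : ∀ {f : ℝ → ℝ}, ContinuousOn f (Icc 0 ℓ) → IntervalIntegrable f volume 0 ℓ := fun h =>
    (by rwa [uIcc_of_le hℓ] : ContinuousOn _ (uIcc 0 ℓ)).intervalIntegrable
  have hS'W : ContinuousOn (fun x => δ ^ 2 / √(W x ^ 2 + δ ^ 2) ^ 3) (Icc 0 ℓ) :=
    hSc.comp_continuousOn hW.continuousOn
  have i2 : IntervalIntegrable (fun x => (ε * W₁ x - lam * W x) *
      (δ ^ 2 / √(W x ^ 2 + δ ^ 2) ^ 3 * W₁ x)) volume 0 ℓ :=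
    hic (hz.continuousOn.mul (hS'W.mul hc₁))
  rw [intervalIntegral.integral_add (hz.intervalIntegrable.mul_continuousOn
      (by rw [uIcc_of_le hℓ]; exact hS.continuousOn)) i2] at h1
  -- The diffusion contribution `ε S'(W) W₁²` is nonnegative and is dropped. The remaining
  -- convection integrand `W S'(W) W₁` is an exact derivative with integral at most `δ`.
  have h3 : -(lam * ∫ x in (0 : ℝ)..ℓ, W x * (δ ^ 2 / √(W x ^ 2 + δ ^ 2) ^ 3) * W₁ x) ≤
      ∫ x in (0 : ℝ)..ℓ, (ε * W₁ x - lam * W x) * (δ ^ 2 / √(W x ^ 2 + δ ^ 2) ^ 3 * W₁ x) := by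
    rw [← intervalIntegral.integral_const_mul, ← intervalIntegral.integral_neg]
    refine intervalIntegral.integral_mono_on hℓ
      (hic (continuousOn_const.mul ((hW.continuousOn.mul hS'W).mul hc₁)).neg)
      i2 fun x _ => ?_
    have hr := sqrt_sq_add_sq_pos hδ (W x)
    have : 0 ≤ ε * (δ ^ 2 / √(W x ^ 2 + δ ^ 2) ^ 3) * W₁ x ^ 2 := by positivity
    nlinarith
  have hT0 : ∀ y : ℝ, 0 ≤ δ ^ 2 / √(y ^ 2 + δ ^ 2) ∧ δ ^ 2 / √(y ^ 2 + δ ^ 2) ≤ δ := fun y => by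
    have hr := sqrt_sq_add_sq_pos hδ y
    refine ⟨by positivity, ?_⟩
    rw [div_le_iff₀ hr, sq]
    exact mul_le_mul_of_nonneg_left (Real.le_sqrt_of_sq_le (by nlinarith [sq_nonneg y])) hδ.le
  have h4 : ∫ x in (0 : ℝ)..ℓ, W x * (δ ^ 2 / √(W x ^ 2 + δ ^ 2) ^ 3) * W₁ x ≤ δ := by
    rw [h2]
    linarith [(hT0 (W ℓ)).1, (hT0 (W 0)).2]
  have h5 := mul_le_mul_of_nonneg_left h4 hlam.le
  linarith

/-- With `g = ε w'' - λ w'` and `S` the smooth sign, pointwise `|w| ≤ w S(w) + δ ≤ |w - θ g| + θ g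
S(w) + δ`; integrating, the term `g S(w)` is bounded by its boundary values. -/
theorem norm_le_norm_sub_smul_add (hℓ : 0 < ℓ) {ε lam δ θ : ℝ} (hε : 0 < ε) (hlam : 0 < lam)
    (hδ : 0 < δ) (hθ : 0 < θ) (w : W21Arc ℓ) :
    ‖w.1 0‖ ≤ ‖w.1 0 - θ • (ε • w.1 2 - lam • w.1 1)‖
      + θ * ((ε * trace (w.1 1) ℓ - lam * trace (w.1 0) ℓ) * smoothSign δ (trace (w.1 0) ℓ)
        - (ε * trace (w.1 1) 0 - lam * trace (w.1 0) 0) * smoothSign δ (trace (w.1 0) 0))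
      + (θ * lam + ℓ) * δ := by
  set W := trace (w.1 0)
  set W₁ := trace (w.1 1)
  have hW : IsPrimitiveOn ℓ W W₁ := W21Arc.isPrimitiveOn_zero hℓ w
  have hW₁ : IsPrimitiveOn ℓ W₁ (w.1 2) := W21Arc.isPrimitiveOn_one hℓ w
  have h0 := integral_mul_smoothSign_le hε hlam hδ hW hW₁
  have hS : ContinuousOn (fun x => smoothSign δ (W x)) (uIcc 0 ℓ) := by
    rw [uIcc_of_le hℓ.le]
    exact (continuous_iff_continuousAt.2 fun y =>
      (hasDerivAt_smoothSign hδ y).continuousAt).comp_continuousOn hW.continuousOn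
  have hWc := hW.continuousOn
  rw [← uIcc_of_le hℓ.le] at hWc
  have ig : IntervalIntegrable (fun x => ε * w.1 2 x - lam * W₁ x) volume 0 ℓ :=
    ((hW₁.const_mul ε).sub (hW.const_mul lam)).intervalIntegrable
  have e1 : ‖w.1 0‖ = ∫ x in (0 : ℝ)..ℓ, |W x| := by
    rw [norm_L1Arc_eq hℓ.le]
    refine intervalIntegral_congr_Ioo hℓ.le ?_
    filter_upwards [w.2.1.ae_eq_trace hℓ] with x hx
    rw [hx]
  have e2 : ‖w.1 0 - θ • (ε • w.1 2 - lam • w.1 1)‖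
      = ∫ x in (0 : ℝ)..ℓ, |W x - θ * (ε * w.1 2 x - lam * W₁ x)| := by
    rw [norm_L1Arc_eq hℓ.le]
    refine intervalIntegral_congr_Ioo hℓ.le ?_
    filter_upwards [w.2.1.ae_eq_trace hℓ, w.2.2.ae_eq_trace hℓ,
      Lp.coeFn_sub (w.1 0) (θ • (ε • w.1 2 - lam • w.1 1)),
      Lp.coeFn_smul θ (ε • w.1 2 - lam • w.1 1), Lp.coeFn_sub (ε • w.1 2) (lam • w.1 1),
      Lp.coeFn_smul ε (w.1 2), Lp.coeFn_smul lam (w.1 1)] with x h1 h2 h3 h4 h5 h6 h7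
    simp only [h3, h4, h5, h6, h7, Pi.sub_apply, Pi.smul_apply, smul_eq_mul]
    rw [h1, h2]
  have h1 : ∫ x in (0 : ℝ)..ℓ, |W x| ≤ ∫ x in (0 : ℝ)..ℓ,
      (|W x - θ * (ε * w.1 2 x - lam * W₁ x)|
        + θ * ((ε * w.1 2 x - lam * W₁ x) * smoothSign δ (W x)) + δ) := by
    refine intervalIntegral.integral_mono_on hℓ.le hWc.abs.intervalIntegrable
      (((hWc.intervalIntegrable.sub (ig.const_mul θ)).abs.add
        ((ig.mul_continuousOn hS).const_mul θ)).add intervalIntegrable_const) fun x _ => ?_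
    have a1 := abs_le_mul_smoothSign_add hδ (W x)
    have a2 := abs_smoothSign_le hδ (W x)
    set g := ε * w.1 2 x - lam * W₁ x
    have a3 : (W x - θ * g) * smoothSign δ (W x) ≤ |W x - θ * g| := by
      refine (le_abs_self _).trans ?_
      rw [abs_mul]
      exact mul_le_of_le_one_right (abs_nonneg _) a2
    linarith
  rw [intervalIntegral.integral_add ((hWc.intervalIntegrable.sub (ig.const_mul θ)).abs.add
        ((ig.mul_continuousOn hS).const_mul θ)) intervalIntegrable_const,
    intervalIntegral.integral_add (hWc.intervalIntegrable.sub (ig.const_mul θ)).abs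
        ((ig.mul_continuousOn hS).const_mul θ), intervalIntegral.integral_const_mul,
    intervalIntegral.integral_const, sub_zero, smul_eq_mul] at h1
  have h2 := mul_le_mul_of_nonneg_left h0 hθ.le
  rw [e1, e2]
  linarith

end Arc

/-! ### The resolvent equation on one arc -/

section ArcEquation

variable {ℓ : ℝ}

theorem isPrimitiveOn_exp (hℓ : 0 ≤ ℓ) (r : ℝ) :
    IsPrimitiveOn ℓ (fun x => Real.exp (r * x)) (fun x => r * Real.exp (r * x)) := by
  refine .of_hasDerivAt hℓ (by fun_prop) (fun x _ => ?_)
    (Continuous.intervalIntegrable (by fun_prop) _ _)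
  exact (((hasDerivAt_id' x).const_mul r).exp).congr_deriv (by ring)

/-- The first order equation `p' = r p + g`, `p 0 = 0`. -/
theorem exists_isPrimitiveOn_mul_add (r : ℝ) {g : ℝ → ℝ} (hℓ : 0 ≤ ℓ)
    (hg : IntervalIntegrable g volume 0 ℓ) :
    ∃ p : ℝ → ℝ, IsPrimitiveOn ℓ p (fun x => r * p x + g x) := by
  have hi : IntervalIntegrable (fun x => Real.exp (-r * x) * g x) volume 0 ℓ :=
    hg.continuousOn_mul (by fun_prop)
  have hG : IsPrimitiveOn ℓ (fun x => ∫ s in (0 : ℝ)..x, Real.exp (-r * s) * g s)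
      (fun x => Real.exp (-r * x) * g x) := ⟨hℓ, hi, fun x _ => by simp⟩
  refine ⟨_, ((isPrimitiveOn_exp hℓ r).mul hG).congr_right (Eventually.of_forall fun x => ?_)⟩
  have : Real.exp (r * x) * Real.exp (-r * x) = 1 := by rw [← Real.exp_add]; simp
  linear_combination g x * this

/-- The characteristic roots of `v - θ (ε v'' - λ v') = 0`. -/
theorem exists_roots {a b : ℝ} (ha : 0 < a) :
    ∃ r s : ℝ, r ≠ s ∧ a * (r + s) = b ∧ a * (r * s) = -1 := by
  have hD : 0 < √(b ^ 2 + 4 * a) := Real.sqrt_pos.2 (by positivity)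
  have hD2 := Real.sq_sqrt (show 0 ≤ b ^ 2 + 4 * a by positivity)
  generalize √(b ^ 2 + 4 * a) = D at *
  refine ⟨(b + D) / (2 * a), (b - D) / (2 * a), ?_, by field_simp; ring, ?_⟩
  · rw [Ne, div_left_inj' (by positivity)]
    intro h
    linarith
  · field_simp
    nlinarith

theorem resolvent_ae_eq {a b : ℝ} {u v w f : L1Arc ℓ}
    (h : ∀ᵐ x ∂volume.restrict (Ioo 0 ℓ), u x - (a * w x - b * v x) = f x) :
    u - (a • w - b • v) = f := by
  refine Lp.ext ?_
  filter_upwards [h, Lp.coeFn_sub u (a • w - b • v), Lp.coeFn_sub (a • w) (b • v),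
    Lp.coeFn_smul a w, Lp.coeFn_smul b v] with x h1 h2 h3 h4 h5
  simp only [h2, h3, h4, h5, Pi.sub_apply, Pi.smul_apply, smul_eq_mul, h1]

/-- The operator factors as `-a (D - r)(D - s)` over the characteristic roots, so two first order
equations are solved in turn: `p' = r p - f/a` and `v' = s v + p`. -/
theorem exists_W21Arc_resolvent (hℓ : 0 < ℓ) {a b : ℝ} (ha : 0 < a) (f : L1Arc ℓ) :
    ∃ w : W21Arc ℓ, w.1 0 - (a • w.1 2 - b • w.1 1) = f := by
  obtain ⟨r, s, -, h1, h2⟩ := exists_roots (b := b) ha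
  obtain ⟨p, hp⟩ := exists_isPrimitiveOn_mul_add r hℓ.le
    ((intervalIntegrable_coeFn hℓ.le f).const_mul (-a⁻¹))
  have hpi : IntervalIntegrable p volume 0 ℓ :=
    (by rw [uIcc_of_le hℓ.le]; exact hp.continuousOn : ContinuousOn p (uIcc 0 ℓ)).intervalIntegrable
  obtain ⟨v, hv⟩ := exists_isPrimitiveOn_mul_add s hℓ.le hpi
  obtain ⟨w, e0, e1, e2, -, -⟩ := exists_W21Arc_of_isPrimitiveOn hℓ hv ((hv.const_mul s).add hp)
  refine ⟨w, resolvent_ae_eq ?_⟩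
  filter_upwards [e0, e1, e2] with x h3 h4 h5
  rw [h3, h4, h5, ← h1]
  have ha' : a * a⁻¹ = 1 := mul_inv_cancel₀ ha.ne'
  linear_combination v x * h2 + f x * ha'

/-- The exponential function as an element of `W^{2,1}`, a solution of the homogeneous equation. -/
theorem exists_W21Arc_exp (hℓ : 0 < ℓ) {a b r s : ℝ} (h1 : a * (r + s) = b)
    (h2 : a * (r * s) = -1) :
    ∃ w : W21Arc ℓ, w.1 0 - (a • w.1 2 - b • w.1 1) = 0 ∧
      trace (w.1 0) 0 = 1 ∧ trace (w.1 1) 0 = r := by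
  obtain ⟨w, e0, e1, e2, t0, t1⟩ := exists_W21Arc_of_isPrimitiveOn hℓ (isPrimitiveOn_exp hℓ.le r)
    ((isPrimitiveOn_exp hℓ.le r).const_mul r)
  refine ⟨w, resolvent_ae_eq ?_, by simp [t0 0 ⟨le_rfl, hℓ.le⟩], by simp [t1 0 ⟨le_rfl, hℓ.le⟩]⟩
  filter_upwards [e0, e1, e2, Lp.coeFn_zero ℝ 1 (volume.restrict (Ioo 0 ℓ))] with x h3 h4 h5 h6
  rw [h3, h4, h5, h6, ← h1, Pi.zero_apply]
  linear_combination Real.exp (r * x) * h2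

/-- The homogeneous solutions of the resolvent equation on one arc. -/
theorem exists_homogeneous (hℓ : 0 < ℓ) {a b : ℝ} (ha : 0 < a) :
    ∃ E : (ℝ × ℝ) →ₗ[ℝ] W21Arc ℓ, Function.Injective E ∧
      ∀ c, (E c).1 0 - (a • (E c).1 2 - b • (E c).1 1) = 0 := by
  obtain ⟨r, s, hrs, h1, h2⟩ := exists_roots (b := b) ha
  obtain ⟨w, w1, w2, w3⟩ := exists_W21Arc_exp hℓ h1 h2
  obtain ⟨v, v1, v2, v3⟩ := exists_W21Arc_exp hℓ (r := s) (s := r) (by rw [add_comm, h1])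
    (by rw [mul_comm s, h2])
  let E : (ℝ × ℝ) →ₗ[ℝ] W21Arc ℓ :=
    (LinearMap.fst ℝ ℝ ℝ).smulRight w + (LinearMap.snd ℝ ℝ ℝ).smulRight v
  have hE : ∀ c k, (E c).1 k = c.1 • w.1 k + c.2 • v.1 k := fun c k => rfl
  refine ⟨E, ?_, fun c => ?_⟩
  · rw [← LinearMap.ker_eq_bot, LinearMap.ker_eq_bot']
    intro c hc
    have h0 : ∀ k, (E c).1 k = 0 := fun k => by rw [hc]; rfl
    have hx : (0 : ℝ) ∈ Icc 0 ℓ := ⟨le_rfl, hℓ.le⟩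
    have htz : trace (0 : L1Arc ℓ) 0 = 0 :=
      trace_eq hℓ (g := fun _ => 0) continuousOn_const
        (Lp.coeFn_zero ℝ 1 (volume.restrict (Ioo 0 ℓ))) hx
    have t0 := congrArg (fun f => trace f 0) ((hE c 0).symm.trans (h0 0))
    have t1 := congrArg (fun f => trace f 0) ((hE c 1).symm.trans (h0 1))
    simp only at t0 t1
    rw [(w.2.1.smul c.1).trace_add hℓ (v.2.1.smul c.2) hx, w.2.1.trace_smul hℓ _ hx,
      v.2.1.trace_smul hℓ _ hx, w2, v2, htz] at t0
    rw [(w.2.2.smul c.1).trace_add hℓ (v.2.2.smul c.2) hx, w.2.2.trace_smul hℓ _ hx,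
      v.2.2.trace_smul hℓ _ hx, w3, v3, htz] at t1
    -- The value and the derivative at `0` give `c₁ + c₂ = 0` and `r c₁ + s c₂ = 0`, which is
    -- nonsingular since `r ≠ s`.
    have h3 : c.1 * (r - s) = 0 := by linear_combination t1 - s * t0
    have h4 : c.1 = 0 := (mul_eq_zero.1 h3).resolve_right (sub_ne_zero.2 hrs)
    refine Prod.ext h4 ?_
    rw [h4] at t0
    simpa using t0
  · rw [hE, hE, hE]
    have := congrArg₂ (fun x y => c.1 • x + c.2 • y) w1 v1
    simp only [smul_zero, add_zero] at this
    rw [← this]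
    module

/-! ### The graph norm -/

theorem abs_integral_le_of_mul (hℓ : 0 < ℓ) (f : L1Arc ℓ) {ψ : ℝ → ℝ} {C : ℝ}
    (hψ : Continuous ψ) (hC : ∀ x, |ψ x| ≤ C) : |∫ x in (0 : ℝ)..ℓ, f x * ψ x| ≤ C * ‖f‖ := by
  have hi := intervalIntegrable_coeFn hℓ.le f
  rw [norm_L1Arc_eq hℓ.le, ← intervalIntegral.integral_const_mul]
  refine (intervalIntegral.abs_integral_le_integral_abs hℓ.le).trans
    (intervalIntegral.integral_mono_on hℓ.le (hi.mul_continuousOn hψ.continuousOn).abs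
      (hi.abs.const_mul C) fun x _ => ?_)
  rw [abs_mul, mul_comm]
  exact mul_le_mul_of_nonneg_right (hC x) (abs_nonneg _)

/-- The norm of `W^{2,1}` is bounded by the graph norm of `ε w'' - λ w'`. -/
theorem exists_norm_W21Arc_le (hℓ : 0 < ℓ) {ε lam : ℝ} (hε : 0 < ε) (hlam : 0 < lam) :
    ∃ C : ℝ, 0 ≤ C ∧ ∀ w : W21Arc ℓ, ‖w‖ ≤ C * (‖w.1 0‖ + ‖ε • w.1 2 - lam • w.1 1‖) := by
  obtain ⟨ρ, r1, r2, r3, r4, r5⟩ := exists_test_integral_eq_one hℓ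
  obtain ⟨M, hM⟩ := r1.continuous.bounded_above_of_compact_support r2
  have hρ' := r1.continuous_deriv (by simp)
  obtain ⟨M', hM'⟩ := hρ'.bounded_above_of_compact_support r2.deriv
  have hM0 : 0 ≤ M := (norm_nonneg _).trans (hM 0)
  have hM'0 : 0 ≤ M' := (norm_nonneg _).trans (hM' 0)
  have hρ : ∫ x in (0 : ℝ)..ℓ, ρ x = 1 := by
    rw [← setIntegral_Ioo_eq hℓ.le, setIntegral_eq_integral_of_forall_compl_eq_zero, r4]
    exact fun x hx => image_eq_zero_of_notMem_tsupport fun h => hx (r3 h)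
  -- The flux `z = ε W' - λ W` has derivative `g`, so its oscillation is at most `‖g‖`. Its `ρ`-mean
  -- is at most `B ‖w‖₁`, after moving the derivative onto `ρ`. Hence `|z| ≤ (B + 1) N`. Solving for
  -- `W'` gives `C₁`, and `ε W'' = g + λ W'` gives `C₂`.
  set B := ε * M' + lam * M
  have hB : 0 ≤ B := by positivity
  set C₁ := (ℓ * (B + 1) + lam) / ε with hC₁
  have hC₁0 : 0 ≤ C₁ := by positivity
  set C₂ := (1 + lam * C₁) / ε with hC₂
  have hC₂0 : 0 ≤ C₂ := by positivity
  refine ⟨1 + C₁ + C₂, by positivity, fun w => ?_⟩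
  set g := ε • w.1 2 - lam • w.1 1
  set N := ‖w.1 0‖ + ‖g‖
  set W := trace (w.1 0)
  set W₁ := trace (w.1 1)
  have hW : IsPrimitiveOn ℓ W W₁ := W21Arc.isPrimitiveOn_zero hℓ w
  have hW₁ : IsPrimitiveOn ℓ W₁ (w.1 2) := W21Arc.isPrimitiveOn_one hℓ w
  have hWae := w.2.1.ae_eq_trace hℓ
  have hW₁ae := w.2.2.ae_eq_trace hℓ
  have hN1 : ‖w.1 0‖ ≤ N := le_add_of_nonneg_right (norm_nonneg _)
  have hN2 : ‖g‖ ≤ N := le_add_of_nonneg_left (norm_nonneg _)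
  have hz : IsPrimitiveOn ℓ (fun x => ε * W₁ x - lam * W x) g := by
    refine ((hW₁.const_mul ε).sub (hW.const_mul lam)).congr_right ?_
    filter_upwards [hW₁ae, Lp.coeFn_sub (ε • w.1 2) (lam • w.1 1), Lp.coeFn_smul ε (w.1 2),
      Lp.coeFn_smul lam (w.1 1)] with x h1 h2 h3 h4
    simp only [g, h2, h3, h4, Pi.sub_apply, Pi.smul_apply, smul_eq_mul]
    rw [h1]
  set z := fun x => ε * W₁ x - lam * W x
  have hosc : ∀ x ∈ Icc 0 ℓ, ∀ y ∈ Icc 0 ℓ, |z x - z y| ≤ ‖g‖ := by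
    intro x hx y hy
    rw [hz.sub_eq hy hx, norm_L1Arc_eq hℓ.le, intervalIntegral.integral_of_le hℓ.le]
    refine (intervalIntegral.norm_integral_le_integral_norm_uIoc (f := fun s => g s)
      (μ := volume) (a := y) (b := x)).trans
      (setIntegral_mono_set ?_ ?_ (Eventually.of_forall fun s hs => ?_))
    · exact (intervalIntegrable_coeFn hℓ.le g).norm.1
    · exact Eventually.of_forall fun _ => norm_nonneg _
    · exact ⟨(le_min hy.1 hx.1).trans_lt hs.1, hs.2.trans (max_le hy.2 hx.2)⟩
  have hzc : ContinuousOn z (uIcc 0 ℓ) := by rw [uIcc_of_le hℓ.le]; exact hz.continuousOn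
  have hWc : ContinuousOn W (uIcc 0 ℓ) := by rw [uIcc_of_le hℓ.le]; exact hW.continuousOn
  have hW₁c : ContinuousOn W₁ (uIcc 0 ℓ) := by rw [uIcc_of_le hℓ.le]; exact hW₁.continuousOn
  have hmean : |∫ y in (0 : ℝ)..ℓ, z y * ρ y| ≤ B * ‖w.1 0‖ := by
    have e1 : ∫ y in (0 : ℝ)..ℓ, z y * ρ y
        = -(ε * ∫ y in (0 : ℝ)..ℓ, w.1 0 y * deriv ρ y)
          - lam * ∫ y in (0 : ℝ)..ℓ, w.1 0 y * ρ y := by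
      have i1 : ∫ y in (0 : ℝ)..ℓ, w.1 0 y * deriv ρ y = -∫ y in (0 : ℝ)..ℓ, W₁ y * ρ y := by
        rw [← hW.integral_mul_deriv (r1.of_le (by exact_mod_cast le_top)) r3]
        refine intervalIntegral_congr_Ioo hℓ.le ?_
        filter_upwards [hWae] with x hx
        rw [hx]
      have i2 : ∫ y in (0 : ℝ)..ℓ, w.1 0 y * ρ y = ∫ y in (0 : ℝ)..ℓ, W y * ρ y := by
        refine intervalIntegral_congr_Ioo hℓ.le ?_
        filter_upwards [hWae] with x hx
        rw [hx]
      rw [i1, i2, mul_neg, neg_neg, ← intervalIntegral.integral_const_mul,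
        ← intervalIntegral.integral_const_mul, ← intervalIntegral.integral_sub]
      · refine intervalIntegral.integral_congr fun x _ => ?_
        simp only [z]; ring
      · exact (hW₁c.mul r1.continuous.continuousOn).intervalIntegrable.const_mul ε
      · exact (hWc.mul r1.continuous.continuousOn).intervalIntegrable.const_mul lam
    have i3 := abs_integral_le_of_mul hℓ (w.1 0) hρ' hM'
    have i4 := abs_integral_le_of_mul hℓ (w.1 0) r1.continuous hM
    rw [e1]
    rw [abs_le] at i3 i4 ⊢
    have := mul_le_mul_of_nonneg_left i3.1 hε.le
    have := mul_le_mul_of_nonneg_left i3.2 hε.le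
    have := mul_le_mul_of_nonneg_left i4.1 hlam.le
    have := mul_le_mul_of_nonneg_left i4.2 hlam.le
    constructor <;> simp only [B] <;> linarith
  have hsup : ∀ x ∈ Icc 0 ℓ, |z x| ≤ (B + 1) * N := by
    intro x hx
    have e1 : z x = (∫ y in (0 : ℝ)..ℓ, z y * ρ y) + ∫ y in (0 : ℝ)..ℓ, (z x - z y) * ρ y := by
      rw [← intervalIntegral.integral_add]
      · simp only [← add_mul, add_sub_cancel]
        rw [intervalIntegral.integral_const_mul, hρ, mul_one]
      · exact (hzc.mul r1.continuous.continuousOn).intervalIntegrable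
      · exact ((continuousOn_const.sub hzc).mul r1.continuous.continuousOn).intervalIntegrable
    have e2 : |∫ y in (0 : ℝ)..ℓ, (z x - z y) * ρ y| ≤ ‖g‖ := by
      have : ‖g‖ = ∫ y in (0 : ℝ)..ℓ, ‖g‖ * ρ y := by
        rw [intervalIntegral.integral_const_mul, hρ, mul_one]
      rw [this]
      refine (intervalIntegral.abs_integral_le_integral_abs hℓ.le).trans
        (intervalIntegral.integral_mono_on hℓ.le
          ((continuousOn_const.sub hzc).mul r1.continuous.continuousOn).abs.intervalIntegrable
          ((r1.continuous.intervalIntegrable _ _).const_mul _) fun y hy => ?_)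
      rw [abs_mul, abs_of_nonneg (r5 y)]
      exact mul_le_mul_of_nonneg_right (hosc x hx y hy) (r5 y)
    calc |z x| ≤ B * ‖w.1 0‖ + ‖g‖ := by
          rw [e1]; exact (abs_add_le _ _).trans (add_le_add hmean e2)
      _ ≤ B * N + N := add_le_add (mul_le_mul_of_nonneg_left hN1 hB) hN2
      _ = (B + 1) * N := by ring
  have h1 : ‖w.1 1‖ ≤ C₁ * N := by
    have e1 : ε * ‖w.1 1‖ ≤ ℓ * ((B + 1) * N) + lam * ‖w.1 0‖ := by
      have i1 : ‖w.1 1‖ = ∫ x in (0 : ℝ)..ℓ, |W₁ x| := by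
        rw [norm_L1Arc_eq hℓ.le]
        refine intervalIntegral_congr_Ioo hℓ.le ?_
        filter_upwards [hW₁ae] with x hx
        rw [hx]
      have i2 : ‖w.1 0‖ = ∫ x in (0 : ℝ)..ℓ, |W x| := by
        rw [norm_L1Arc_eq hℓ.le]
        refine intervalIntegral_congr_Ioo hℓ.le ?_
        filter_upwards [hWae] with x hx
        rw [hx]
      have i3 : ℓ * ((B + 1) * N) = ∫ _ in (0 : ℝ)..ℓ, (B + 1) * N := by simp; ring
      rw [i1, i2, i3, ← intervalIntegral.integral_const_mul, ← intervalIntegral.integral_const_mul,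
        ← intervalIntegral.integral_add intervalIntegrable_const
          (hWc.abs.intervalIntegrable.const_mul lam)]
      refine intervalIntegral.integral_mono_on hℓ.le (hW₁c.abs.intervalIntegrable.const_mul ε)
        (intervalIntegrable_const.add (hWc.abs.intervalIntegrable.const_mul lam)) fun x hx => ?_
      have := hsup x hx
      rw [← abs_of_pos hε, ← abs_of_pos hlam, ← abs_mul, ← abs_mul]
      have e : ε * W₁ x = z x + lam * W x := by simp only [z]; ring
      rw [e]
      exact (abs_add_le _ _).trans (add_le_add_left this _)
    rw [hC₁, div_mul_eq_mul_div, le_div_iff₀ hε]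
    nlinarith
  have h2 : ‖w.1 2‖ ≤ C₂ * N := by
    have e : ε • w.1 2 = g + lam • w.1 1 := by simp only [g]; abel
    have e1 := congrArg norm e
    rw [norm_smul, Real.norm_of_nonneg hε.le] at e1
    have e2 := norm_add_le g (lam • w.1 1)
    rw [norm_smul, Real.norm_of_nonneg hlam.le] at e2
    rw [hC₂, div_mul_eq_mul_div, le_div_iff₀ hε]
    nlinarith
  rw [W21Arc.norm_eq]
  linarith

/-! ### Density and lifts -/

/-- The functions of `W^{2,1}` which vanish at the end points to first order are dense in `L¹`. -/
theorem exists_W21Arc_norm_sub_lt (hℓ : 0 < ℓ) (f : L1Arc ℓ) {η : ℝ} (hη : 0 < η) :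
    ∃ w : W21Arc ℓ, ‖f - w.1 0‖ < η ∧ ∀ x, x = 0 ∨ x = ℓ →
      trace (w.1 0) x = 0 ∧ trace (w.1 1) x = 0 := by
  obtain ⟨g, hfg, G, hgG, -, hG⟩ := Metric.dense_iff.1 (Lp.dense_hasCompactSupport_contDiff
    (F := ℝ) (μ := volume.restrict (Ioo 0 ℓ)) (p := 1) ENNReal.one_ne_top) f (η / 2) (by positivity)
  rw [Metric.mem_ball, dist_eq_norm] at hfg
  -- Cut-offs with values in `[0, 1]` on the arc, zero at both ends and tending to `1` inside. Their
  -- zeros at the ends are simple, so the square is used to make the derivative vanish there too.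
  let A : ℕ → ℝ → ℝ := fun n x => 1 - (1 - x * (ℓ - x) / ℓ ^ 2) ^ n
  have hA : ∀ n, ContDiff ℝ 2 (A (n + 1)) := fun n => by fun_prop
  have hG2 : ContDiff ℝ 2 G := contDiff_infty.1 hG 2
  have hs : ∀ x ∈ Ioo 0 ℓ, 0 < x * (ℓ - x) / ℓ ^ 2 ∧ x * (ℓ - x) / ℓ ^ 2 < 1 := fun x hx => by
    have := sub_pos.2 hx.2
    have := hx.1
    refine ⟨by positivity, ?_⟩
    rw [div_lt_one (by positivity)]
    nlinarith
  have hlim : Tendsto (fun n => ∫ x in Ioo 0 ℓ, |g x - A (n + 1) x ^ 2 * G x|) atTop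
      (𝓝 (∫ x in Ioo 0 ℓ, (0 : ℝ))) := by
    refine tendsto_integral_of_dominated_convergence (fun x => |g x|) (fun n => ?_)
      (L1.integrable_coeFn g).abs (fun n => ?_) ?_
    · exact ((L1.integrable_coeFn g).aestronglyMeasurable.sub
        (((hA n).continuous.pow 2).mul hG2.continuous).aestronglyMeasurable).norm
    · filter_upwards [hgG, ae_restrict_mem measurableSet_Ioo] with x h1 h2
      rw [← h1, Real.norm_eq_abs, abs_abs]
      have h3 : 0 ≤ (1 - x * (ℓ - x) / ℓ ^ 2) ^ (n + 1) :=
        pow_nonneg (by linarith [(hs x h2).2]) _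
      have h4 : (1 - x * (ℓ - x) / ℓ ^ 2) ^ (n + 1) ≤ 1 :=
        pow_le_one₀ (by linarith [(hs x h2).2]) (by linarith [(hs x h2).1])
      have e : g x - A (n + 1) x ^ 2 * g x = (1 - A (n + 1) x ^ 2) * g x := by ring
      rw [e, abs_mul]
      refine mul_le_of_le_one_left (abs_nonneg _) ?_
      rw [abs_le]
      simp only [A]
      constructor <;> nlinarith
    · filter_upwards [hgG, ae_restrict_mem measurableSet_Ioo] with x h1 h2
      have h3 : Tendsto (fun n => A (n + 1) x) atTop (𝓝 (1 - 0)) :=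
        tendsto_const_nhds.sub ((tendsto_pow_atTop_nhds_zero_of_lt_one
          (by linarith [(hs x h2).2]) (by linarith [(hs x h2).1])).comp (tendsto_add_atTop_nat 1))
      have h4 := ((tendsto_const_nhds (x := g x)).sub ((h3.pow 2).mul_const (G x))).abs
      simpa [h1] using h4
  rw [integral_zero] at hlim
  obtain ⟨n, hn⟩ := (hlim.eventually (gt_mem_nhds (show 0 < η / 2 by positivity))).exists
  let q : ℝ → ℝ := fun x => A (n + 1) x ^ 2 * G x
  have hq : ContDiff ℝ 2 q := ((hA n).pow 2).mul hG2
  have hq' : ∀ x, x = 0 ∨ x = ℓ → q x = 0 ∧ deriv q x = 0 := by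
    intro x hx
    have hAx : A (n + 1) x = 0 := by rcases hx with rfl | rfl <;> simp [A]
    refine ⟨by simp [q, hAx], ?_⟩
    have d1 := ((hA n).differentiable two_ne_zero x).hasDerivAt
    have d2 := (hG2.differentiable two_ne_zero x).hasDerivAt
    rw [((d1.fun_pow 2).fun_mul d2).deriv]
    simp [hAx]
  have p0 : IsPrimitiveOn ℓ q (deriv q) := .of_contDiff hℓ.le (hq.of_le one_le_two)
  have p1 : IsPrimitiveOn ℓ (deriv q) (deriv (deriv q)) :=
    .of_contDiff hℓ.le (ContDiff.deriv' (by rwa [one_add_one_eq_two]))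
  obtain ⟨w, e0, -, -, t0, t1⟩ := exists_W21Arc_of_isPrimitiveOn hℓ p0 p1
  refine ⟨w, ?_, fun x hx => ?_⟩
  · have h1 : ‖g - w.1 0‖ < η / 2 := by
      refine lt_of_eq_of_lt ?_ hn
      rw [L1.norm_eq_integral_norm]
      refine integral_congr_ae ?_
      filter_upwards [e0, Lp.coeFn_sub g (w.1 0)] with x h1 h2
      rw [h2, Pi.sub_apply, h1, Real.norm_eq_abs]
    rw [norm_sub_rev] at hfg
    calc ‖f - w.1 0‖ = ‖(f - g) + (g - w.1 0)‖ := by rw [sub_add_sub_cancel]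
      _ ≤ ‖f - g‖ + ‖g - w.1 0‖ := norm_add_le _ _
      _ < η := by linarith
  · have hx' : x ∈ Icc 0 ℓ := by
      rcases hx with rfl | rfl
      exacts [⟨le_rfl, hℓ.le⟩, ⟨hℓ.le, le_rfl⟩]
    rw [t0 x hx', t1 x hx']
    exact hq' x hx

end ArcEquation

/-! ### The operator on the network -/

namespace StarNetwork

variable {ι : Type*} [Fintype ι] (P : StarNetwork ι)

theorem innerEnd_mem (i : ι) : P.innerEnd i ∈ Icc 0 (P.len i) := by
  have := P.len_pos i
  unfold innerEnd
  split_ifs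
  exacts [⟨this.le, le_rfl⟩, ⟨le_rfl, this.le⟩]

theorem outerEnd_mem (i : ι) : P.outerEnd i ∈ Icc 0 (P.len i) := by
  have := P.len_pos i
  unfold outerEnd
  split_ifs
  exacts [⟨le_rfl, this.le⟩, ⟨this.le, le_rfl⟩]

theorem innerEnd_eq (i : ι) : P.innerEnd i = 0 ∨ P.innerEnd i = P.len i := by
  unfold innerEnd
  split_ifs <;> simp

theorem outerEnd_ne_innerEnd (i : ι) : P.outerEnd i - P.innerEnd i ≠ 0 := by
  have := P.len_pos i
  unfold outerEnd innerEnd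
  split_ifs <;> simp [this.ne']

variable {P} in
theorem W21.ext_der {w v : P.W21} (h : W21.der w 0 = W21.der v 0) : w = v :=
  PiLp.ext fun i => W21Arc.ext_zero (congrArg (fun f : P.L1 => f i) h)

/-- The derivative of order `k` as a linear map. -/
def derLinear (k : Fin 3) : P.W21 →ₗ[ℝ] P.L1 where
  toFun w := W21.der w k
  map_add' _ _ := rfl
  map_smul' _ _ := rfl

/-- The differential expression as a linear map. -/
def diffOpLinear : P.W21 →ₗ[ℝ] P.L1 where
  toFun := P.diffOp
  map_add' w v := PiLp.ext fun i => by
    change P.eps • ((w i).1 2 + (v i).1 2) - P.lam i • ((w i).1 1 + (v i).1 1)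
      = (P.eps • (w i).1 2 - P.lam i • (w i).1 1) + (P.eps • (v i).1 2 - P.lam i • (v i).1 1)
    module
  map_smul' c w := PiLp.ext fun i => by
    change P.eps • (c • (w i).1 2) - P.lam i • (c • (w i).1 1)
      = c • (P.eps • (w i).1 2 - P.lam i • (w i).1 1)
    module

/-- The values of the functions at the point `x i` of each arc. -/
def valueAt (x : ι → ℝ) (hx : ∀ i, x i ∈ Icc 0 (P.len i)) : P.W21 →ₗ[ℝ] (ι → ℝ) where
  toFun w i := trace (W21.der w 0 i) (x i)
  map_add' w v := funext fun i => (w i).2.1.trace_add (P.len_pos i) (v i).2.1 (hx i)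
  map_smul' c w := funext fun i => (w i).2.1.trace_smul (P.len_pos i) c (hx i)

/-- The values of the first derivatives at the point `x i` of each arc. -/
def derivAt (x : ι → ℝ) (hx : ∀ i, x i ∈ Icc 0 (P.len i)) : P.W21 →ₗ[ℝ] (ι → ℝ) where
  toFun w i := trace (W21.der w 1 i) (x i)
  map_add' w v := funext fun i => (w i).2.2.trace_add (P.len_pos i) (v i).2.2 (hx i)
  map_smul' c w := funext fun i => (w i).2.2.trace_smul (P.len_pos i) c (hx i)

/-- The values at the outer nodes. -/
def outerValue : P.W21 →ₗ[ℝ] (ι → ℝ) := P.valueAt P.outerEnd P.outerEnd_mem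

/-- The defect in the transmission conditions, for given values and derivatives at the inner
node. -/
def nodeDefect : (ι → ℝ) × (ι → ℝ) →ₗ[ℝ] (ι → ℝ) where
  toFun p i := P.beta i * (-P.lam i * p.1 i + P.eps * p.2 i) - ∑ j, P.K i j * (p.1 j - p.1 i)
  map_add' p q := funext fun i => by
    have : ∀ j, P.K i j * ((p + q).1 j - (p + q).1 i)
        = P.K i j * (p.1 j - p.1 i) + P.K i j * (q.1 j - q.1 i) := fun j => by
      simp only [Prod.fst_add, Pi.add_apply]; ring
    simp only [this, Finset.sum_add_distrib]
    simp only [Prod.fst_add, Prod.snd_add, Pi.add_apply]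
    ring
  map_smul' c p := funext fun i => by
    have : ∀ j, P.K i j * ((c • p).1 j - (c • p).1 i) = c * (P.K i j * (p.1 j - p.1 i)) :=
      fun j => by simp only [Prod.smul_fst, Pi.smul_apply, smul_eq_mul]; ring
    simp only [this, ← Finset.mul_sum]
    simp only [Prod.smul_fst, Prod.smul_snd, Pi.smul_apply, smul_eq_mul, RingHom.id_apply]
    ring

/-- The defect in the transmission conditions. -/
def defect : P.W21 →ₗ[ℝ] (ι → ℝ) :=
  P.nodeDefect ∘ₗ (P.valueAt P.innerEnd P.innerEnd_mem).prod (P.derivAt P.innerEnd P.innerEnd_mem)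

theorem transmission_iff (w : P.W21) : P.Transmission w ↔ P.defect w = 0 := by
  rw [funext_iff]
  exact forall_congr' fun i => sub_eq_zero.symm

theorem transmission_of_eq_zero {w : P.W21} (h0 : ∀ i, trace (W21.der w 0 i) (P.innerEnd i) = 0)
    (h1 : ∀ i, trace (W21.der w 1 i) (P.innerEnd i) = 0) : P.Transmission w := fun i => by
  simp [h0, h1]

/-- The functions which satisfy the homogeneous boundary and the transmission conditions. -/
def domain : Submodule ℝ P.W21 := LinearMap.ker P.outerValue ⊓ LinearMap.ker P.defect

variable {P} in
theorem mem_domain {w : P.W21} : w ∈ P.domain ↔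
    (∀ i, trace (W21.der w 0 i) (P.outerEnd i) = 0) ∧ P.Transmission w := by
  rw [transmission_iff]
  exact and_congr (LinearMap.mem_ker.trans funext_iff) LinearMap.mem_ker

/-- The graph of the operator as a linear subspace. -/
def graph : Submodule ℝ (P.L1 × P.L1) := P.domain.map ((P.derLinear 0).prod P.diffOpLinear)

theorem coe_graph : (P.graph : Set (P.L1 × P.L1)) = P.A₀ := by
  ext p
  constructor
  · rintro ⟨w, hw, rfl⟩
    exact ⟨w, (mem_domain.1 hw).1, (mem_domain.1 hw).2, rfl⟩
  · rintro ⟨w, h1, h2, rfl⟩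
    exact ⟨w, mem_domain.2 ⟨h1, h2⟩, rfl⟩

/-- Symmetry of `K` permits exchanging `i` and `j`; adding both forms, twice the sum is `-∑ K i j (a
i - a j)(S (a i) - S (a j))`, and monotonicity gives the sign of each term. -/
theorem sum_coupling_mul_nonpos (a : ι → ℝ) {S : ℝ → ℝ} (hS : Monotone S) :
    ∑ i, (∑ j, P.K i j * (a j - a i)) * S (a i) ≤ 0 := by
  set X := ∑ i, (∑ j, P.K i j * (a j - a i)) * S (a i) with hX
  have h1 : X = ∑ i, ∑ j, P.K i j * (a j - a i) * S (a i) := by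
    simp only [hX, Finset.sum_mul]
  have h2 : X = ∑ i, ∑ j, P.K i j * (a i - a j) * S (a j) := by
    rw [h1, Finset.sum_comm]
    refine Finset.sum_congr rfl fun i _ => Finset.sum_congr rfl fun j _ => ?_
    rw [P.K_symm j i]
  have h3 : X + X ≤ 0 := by
    nth_rw 1 [h1]
    rw [h2, ← Finset.sum_add_distrib]
    refine Finset.sum_nonpos fun i _ => ?_
    rw [← Finset.sum_add_distrib]
    refine Finset.sum_nonpos fun j _ => ?_
    have h4 : 0 ≤ (a i - a j) * (S (a i) - S (a j)) := by
      rcases le_total (a i) (a j) with h | h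
      · exact mul_nonneg_of_nonpos_of_nonpos (sub_nonpos.2 h) (sub_nonpos.2 (hS h))
      · exact mul_nonneg (sub_nonneg.2 h) (sub_nonneg.2 (hS h))
    have := mul_nonneg (P.K_nonneg i j) h4
    linarith
  linarith

theorem norm_der_le {w : P.W21} (hw : w ∈ P.domain) {θ : ℝ} (hθ : 0 < θ) :
    ‖W21.der w 0‖ ≤ ‖W21.der w 0 - θ • P.diffOp w‖ := by
  obtain ⟨h1, h2⟩ := mem_domain.1 hw
  set C := ∑ i, (θ * P.lam i + P.len i) with hC
  have hC0 : 0 ≤ C := Finset.sum_nonneg fun i _ =>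
    add_nonneg (mul_nonneg hθ.le (P.lam_pos i).le) (P.len_pos i).le
  have key : ∀ δ : ℝ, 0 < δ → ‖W21.der w 0‖ ≤ ‖W21.der w 0 - θ • P.diffOp w‖ + C * δ := by
    intro δ hδ
    -- The outer end contributes nothing, since the trace vanishes there and `smoothSign δ 0 = 0`.
    -- The inner end enters with sign `beta i`, exactly as in the transmission condition.
    have hb : ∀ i, (P.eps * trace ((w i).1 1) (P.len i) - P.lam i * trace ((w i).1 0) (P.len i))
          * smoothSign δ (trace ((w i).1 0) (P.len i))
        - (P.eps * trace ((w i).1 1) 0 - P.lam i * trace ((w i).1 0) 0)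
          * smoothSign δ (trace ((w i).1 0) 0)
        = (∑ j, P.K i j * (trace ((w j).1 0) (P.innerEnd j) - trace ((w i).1 0) (P.innerEnd i)))
          * smoothSign δ (trace ((w i).1 0) (P.innerEnd i)) := by
      intro i
      have h3 : P.beta i * (-P.lam i * trace ((w i).1 0) (P.innerEnd i)
          + P.eps * trace ((w i).1 1) (P.innerEnd i)) = _ := h2 i
      have h4 : trace ((w i).1 0) (P.outerEnd i) = 0 := h1 i
      refine Eq.trans ?_ (congrArg (· * smoothSign δ (trace ((w i).1 0) (P.innerEnd i))) h3)
      unfold beta innerEnd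
      unfold outerEnd at h4
      split_ifs at h4 ⊢ <;> rw [h4, smoothSign_zero] <;> ring
    rw [PiLp.norm_eq_of_L1, PiLp.norm_eq_of_L1]
    calc ∑ i, ‖W21.der w 0 i‖ ≤ ∑ i, (‖(W21.der w 0 - θ • P.diffOp w) i‖
          + θ * ((∑ j, P.K i j * (trace ((w j).1 0) (P.innerEnd j)
            - trace ((w i).1 0) (P.innerEnd i)))
          * smoothSign δ (trace ((w i).1 0) (P.innerEnd i))) + (θ * P.lam i + P.len i) * δ) := by
          refine Finset.sum_le_sum fun i _ => ?_
          rw [← hb i]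
          exact norm_le_norm_sub_smul_add (P.len_pos i) P.eps_pos (P.lam_pos i) hδ hθ (w i)
      _ ≤ _ := by
          rw [Finset.sum_add_distrib, Finset.sum_add_distrib, ← Finset.mul_sum, ← Finset.sum_mul]
          have := P.sum_coupling_mul_nonpos (fun i => trace ((w i).1 0) (P.innerEnd i))
            (monotone_smoothSign hδ)
          have := mul_nonpos_of_nonneg_of_nonpos hθ.le this
          linarith
  refine le_of_forall_pos_le_add fun η hη => (key (η / (C + 1)) (by positivity)).trans ?_
  gcongr
  rw [mul_div_assoc', div_le_iff₀ (by positivity)]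
  nlinarith

/-- Arcwise particular solutions are corrected by homogeneous ones. The boundary data of the latter
depend linearly on the constants; a kernel element would be a domain element with zero right side,
hence zero by dissipativity. -/
theorem exists_mem_domain_resolvent {θ : ℝ} (hθ : 0 < θ) (f : P.L1) :
    ∃ w ∈ P.domain, W21.der w 0 - θ • P.diffOp w = f := by
  have ha : 0 < θ * P.eps := mul_pos hθ P.eps_pos
  choose p hp using fun i =>
    exists_W21Arc_resolvent (P.len_pos i) (b := θ * P.lam i) ha (f i)
  choose E hEinj hE using fun i => exists_homogeneous (P.len_pos i) (b := θ * P.lam i) ha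
  have hop : ∀ (w : P.W21) i, (W21.der w 0 - θ • P.diffOp w) i
      = (w i).1 0 - ((θ * P.eps) • (w i).1 2 - (θ * P.lam i) • (w i).1 1) := fun w i => by
    change (w i).1 0 - θ • (P.eps • (w i).1 2 - P.lam i • (w i).1 1) = _
    module
  let H : (ι → ℝ × ℝ) →ₗ[ℝ] P.W21 :=
    { toFun := fun c => WithLp.toLp 1 fun i => E i (c i)
      map_add' := fun c d => PiLp.ext fun i => (E i).map_add (c i) (d i)
      map_smul' := fun r c => PiLp.ext fun i => (E i).map_smul r (c i) }
  have hH : ∀ c, W21.der (H c) 0 - θ • P.diffOp (H c) = 0 := fun c =>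
    PiLp.ext fun i => (hop (H c) i).trans (hE i (c i))
  let B : (ι → ℝ × ℝ) →ₗ[ℝ] (ι → ℝ) × (ι → ℝ) := (P.outerValue.prod P.defect) ∘ₗ H
  have hB : Function.Injective B := by
    rw [← LinearMap.ker_eq_bot, LinearMap.ker_eq_bot']
    intro c hc
    have hmem : H c ∈ P.domain :=
      ⟨congrArg Prod.fst hc, congrArg Prod.snd hc⟩
    have h1 := P.norm_der_le hmem hθ
    rw [hH, norm_zero] at h1
    have h2 : H c = 0 := W21.ext_der (norm_le_zero_iff.1 h1)
    refine funext fun i => hEinj i ?_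
    rw [Pi.zero_apply, map_zero]
    exact congrArg (fun w : P.W21 => w i) h2
  have hBs : Function.Surjective B :=
    -- Both spaces have dimension twice the number of arcs.
    (LinearMap.injective_iff_surjective_of_finrank_eq_finrank (by
      rw [Module.finrank_pi_fintype, Module.finrank_prod]
      simp [mul_two])).1 hB
  let w₀ : P.W21 := WithLp.toLp 1 p
  obtain ⟨c, hc⟩ := hBs (P.outerValue w₀, P.defect w₀)
  refine ⟨w₀ - H c, ⟨?_, ?_⟩, ?_⟩
  · change P.outerValue (w₀ - H c) = 0
    rw [map_sub, sub_eq_zero]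
    exact (congrArg Prod.fst hc).symm
  · change P.defect (w₀ - H c) = 0
    rw [map_sub, sub_eq_zero]
    exact (congrArg Prod.snd hc).symm
  · have h1 : W21.der w₀ 0 - θ • P.diffOp w₀ = f := PiLp.ext fun i => (hop w₀ i).trans (hp i)
    have h2 : W21.der (w₀ - H c) 0 - θ • P.diffOp (w₀ - H c)
        = (W21.der w₀ 0 - θ • P.diffOp w₀) - (W21.der (H c) 0 - θ • P.diffOp (H c)) := by
      have e1 : W21.der (w₀ - H c) 0 = W21.der w₀ 0 - W21.der (H c) 0 :=
        map_sub (P.derLinear 0) w₀ (H c)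
      have e2 : P.diffOp (w₀ - H c) = P.diffOp w₀ - P.diffOp (H c) :=
        map_sub P.diffOpLinear w₀ (H c)
      rw [e1, e2]
      module
    rw [h2, h1, hH, sub_zero]

/-- Functions vanishing to first order at all end points satisfy every boundary and transmission
condition and are already dense. -/
theorem dense_domain : Dense (Prod.fst '' (P.graph : Set (P.L1 × P.L1))) := by
  refine Metric.dense_iff.2 fun f η hη => ?_
  choose w hw hw0 using fun i =>
    exists_W21Arc_norm_sub_lt (P.len_pos i) (f i) (η := η / (Fintype.card ι + 1)) (by positivity)
  let v : P.W21 := WithLp.toLp 1 w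
  have hv : v ∈ P.domain := by
    refine mem_domain.2 ⟨fun i => (hw0 i _ ?_).1, P.transmission_of_eq_zero
      (fun i => (hw0 i _ (P.innerEnd_eq i)).1) fun i => (hw0 i _ (P.innerEnd_eq i)).2⟩
    unfold outerEnd
    split_ifs <;> simp
  refine ⟨W21.der v 0, ?_, _, ⟨v, hv, rfl⟩, rfl⟩
  rw [Metric.mem_ball, dist_eq_norm, norm_sub_rev, PiLp.norm_eq_of_L1]
  calc ∑ i, ‖(f - W21.der v 0) i‖ ≤ ∑ _i : ι, η / (Fintype.card ι + 1) :=
        Finset.sum_le_sum fun i _ => (hw i).le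
    _ < η := by
        rw [Finset.sum_const, nsmul_eq_mul, Finset.card_univ, mul_div_assoc',
          div_lt_iff₀ (by positivity)]
        linarith

/-- The norm of `W^{2,1}` is bounded by the graph norm of the operator. -/
theorem exists_norm_le : ∃ C : ℝ, ∀ w : P.W21, ‖w‖ ≤ C * (‖W21.der w 0‖ + ‖P.diffOp w‖) := by
  choose C hC0 hC using fun i => exists_norm_W21Arc_le (P.len_pos i) P.eps_pos (P.lam_pos i)
  refine ⟨∑ i, C i, fun w => ?_⟩
  have hle : ∀ (f : P.L1) i, ‖f i‖ ≤ ‖f‖ := fun f i => by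
    rw [PiLp.norm_eq_of_L1]
    exact Finset.single_le_sum (f := fun i => ‖f i‖) (fun i _ => norm_nonneg _) (Finset.mem_univ i)
  rw [PiLp.norm_eq_of_L1, Finset.sum_mul]
  refine Finset.sum_le_sum fun i _ => (hC i (w i)).trans ?_
  exact mul_le_mul_of_nonneg_left (add_le_add (hle (W21.der w 0) i) (hle (P.diffOp w) i)) (hC0 i)

/-- Semigroup theory yields continuity in the graph norm only; the graph norm estimate upgrades it
to `W^{2,1}`. -/
theorem continuousOn_of_der_of_diffOp {u : ℝ → P.W21} {s : Set ℝ}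
    (h0 : ContinuousOn (fun t => W21.der (u t) 0) s)
    (h1 : ContinuousOn (fun t => P.diffOp (u t)) s) : ContinuousOn u s := by
  obtain ⟨C, hC⟩ := P.exists_norm_le
  intro t ht
  rw [ContinuousWithinAt, tendsto_iff_norm_sub_tendsto_zero]
  have a0 := tendsto_iff_norm_sub_tendsto_zero.1 (h0 t ht)
  have a1 := tendsto_iff_norm_sub_tendsto_zero.1 (h1 t ht)
  have a2 := (a0.add a1).const_mul C
  rw [add_zero, mul_zero] at a2
  refine squeeze_zero (fun _ => norm_nonneg _) (fun r => (hC (u r - u t)).trans_eq ?_) a2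
  have e1 : W21.der (u r - u t) 0 = W21.der (u r) 0 - W21.der (u t) 0 :=
    map_sub (P.derLinear 0) (u r) (u t)
  have e2 : P.diffOp (u r - u t) = P.diffOp (u r) - P.diffOp (u t) :=
    map_sub P.diffOpLinear (u r) (u t)
  rw [e1, e2]

theorem isMDissipative : IsMDissipative P.A₀ := by
  refine ⟨?_, 1, one_pos, fun f => ?_⟩
  · rintro _ ⟨w, h1, h2, rfl⟩ θ hθ
    exact P.norm_der_le (mem_domain.2 ⟨h1, h2⟩) hθ
  · obtain ⟨w, hw, hf⟩ := P.exists_mem_domain_resolvent one_pos f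
    exact ⟨_, ⟨w, (mem_domain.1 hw).1, (mem_domain.1 hw).2, rfl⟩, hf⟩

theorem existsUnique_semigroup : ∃! τ : ContractionSemigroup P.L1, τ.generator = P.A₀ := by
  obtain ⟨R⟩ := ResolventSeq.exists_of_dissipative (A := P.graph)
    (fun p hp θ hθ => P.isMDissipative.1 p (P.coe_graph ▸ hp) θ hθ) (fun θ hθ f => by
      obtain ⟨w, hw, hf⟩ := P.exists_mem_domain_resolvent hθ f
      exact ⟨_, ⟨w, hw, rfl⟩, hf⟩)
  have hR : (R.semigroup P.dense_domain).generator = P.A₀ :=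
    (R.generator_semigroup P.dense_domain).trans P.coe_graph
  refine ⟨R.semigroup P.dense_domain, hR, fun σ hσ => ?_⟩
  refine ContractionSemigroup.eq_of_generator_eq _ (hσ.trans hR.symm) ?_
  rw [hR, ← P.coe_graph]
  exact P.dense_domain

/-! ### The parabolic problem -/

theorem exists_isLift (u₀ : P.W21) : ∃ q : ι → ℝ → ℝ, P.IsLift u₀ q := by
  -- The lift is a multiple of the squared distance to `N`, which vanishes there to first order; the
  -- quotient normalises it at the outer node.
  let c : ι → ℝ := fun i =>
    trace (W21.der u₀ 0 i) (P.outerEnd i) / (P.outerEnd i - P.innerEnd i) ^ 2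
  have hd : ∀ i x, HasDerivAt (fun x => c i * (x - P.innerEnd i) ^ 2)
      (c i * (2 * (x - P.innerEnd i))) x := fun i x => by
    simpa using (((hasDerivAt_id' x).sub_const (P.innerEnd i)).fun_pow 2).const_mul (c i)
  refine ⟨fun i x => c i * (x - P.innerEnd i) ^ 2, fun i => ?_, fun i => ?_, fun i => ?_,
    fun i => ?_⟩
  · exact ContDiff.contDiffOn (by fun_prop)
  · exact div_mul_cancel₀ _ (pow_ne_zero 2 (P.outerEnd_ne_innerEnd i))
  · simp
  · rw [(hd i _).hasDerivWithinAt.derivWithin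
      (uniqueDiffOn_Icc (P.len_pos i) _ (P.innerEnd_mem i))]
    simp

variable {P}

/-- A lift is the class of an element of `W^{2,1}`. -/
theorem IsLift.exists_W21 {u₀ : P.W21} {q : ι → ℝ → ℝ} (hq : P.IsLift u₀ q) :
    ∃ Q : P.W21, P.IsClassOf (W21.der Q 0) q ∧ P.IsClassOf (P.diffOp Q) (P.source q) ∧
      P.Transmission Q ∧ P.outerValue Q = P.outerValue u₀ := by
  have hq2 : ∀ i, ContDiffOn ℝ 2 (q i) (Icc 0 (P.len i)) := fun i =>
    contDiffOn_infty.1 (hq.smooth i) 2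
  choose w e0 e1 e2 t0 t1 using fun i => exists_W21Arc_of_isPrimitiveOn (P.len_pos i)
    (isPrimitiveOn_derivWithin (P.len_pos i) ((hq2 i).of_le one_le_two))
    (isPrimitiveOn_iteratedDerivWithin_two (P.len_pos i) (hq2 i))
  refine ⟨WithLp.toLp 1 w, e0, fun i => ?_, P.transmission_of_eq_zero (fun i => ?_) fun i => ?_,
    funext fun i => ?_⟩
  · change (P.eps • (w i).1 2 - P.lam i • (w i).1 1 : L1Arc (P.len i)) =ᵐ[_] _
    filter_upwards [e1 i, e2 i, Lp.coeFn_sub (P.eps • (w i).1 2) (P.lam i • (w i).1 1),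
      Lp.coeFn_smul P.eps ((w i).1 2), Lp.coeFn_smul (P.lam i) ((w i).1 1)] with x h1 h2 h3 h4 h5
    simp only [h3, h4, h5, Pi.sub_apply, Pi.smul_apply, smul_eq_mul, h1, h2, source]
  · exact (t0 i _ (P.innerEnd_mem i)).trans (hq.inner_eq i)
  · exact (t1 i _ (P.innerEnd_mem i)).trans (hq.inner_deriv i)
  · exact (t0 i _ (P.outerEnd_mem i)).trans (hq.outer_eq i)

/-- `u - Q` starts in the domain and solves `w' = A w + F` with `F` constant in time, so the mild
solution stays in the domain and is `C¹`; adding `Q` restores the outer values. -/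
theorem exists_isSolution {τ : ContractionSemigroup P.L1} (hτ : τ.generator = P.A₀) {u₀ Q : P.W21}
    (hu₀ : P.Transmission u₀) (hQ : P.Transmission Q) (hout : P.outerValue Q = P.outerValue u₀) :
    ∃ u : ℝ → P.W21, P.IsSolution u₀ u ∧ ∀ t, 0 ≤ t → W21.der (u t) 0
      = τ.mild (W21.der u₀ 0 - W21.der Q 0) (P.diffOp Q) t + W21.der Q 0 := by
  have hmem : u₀ - Q ∈ P.domain := by
    refine ⟨?_, ?_⟩
    · change P.outerValue (u₀ - Q) = 0
      rw [map_sub, hout, sub_self]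
    · change P.defect (u₀ - Q) = 0
      rw [map_sub, (P.transmission_iff u₀).1 hu₀, (P.transmission_iff Q).1 hQ, sub_self]
  set x := W21.der u₀ 0 - W21.der Q 0
  set y := P.diffOp (u₀ - Q)
  set F := P.diffOp Q
  have hgen : (x, y) ∈ τ.generator := by
    rw [hτ]
    exact ⟨u₀ - Q, (mem_domain.1 hmem).1, (mem_domain.1 hmem).2, rfl⟩
  have hw : ∀ t : ℝ, ∃ w ∈ P.domain, 0 ≤ t → W21.der w 0 = τ.mild x F t ∧
      P.diffOp w = τ.orbit y t + (τ.orbit F t - F) := fun t => by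
    by_cases ht : 0 ≤ t
    · have := τ.mild_mem_generator hgen F ht
      rw [hτ, ← P.coe_graph] at this
      obtain ⟨w, hw, he⟩ := this
      exact ⟨w, hw, fun _ => ⟨congrArg Prod.fst he, congrArg Prod.snd he⟩⟩
    -- Negative times carry no condition, so any element of the domain serves.
    · exact ⟨0, zero_mem _, fun h => absurd h ht⟩
  choose w hwd hw using hw
  have hder : ∀ t, 0 ≤ t → W21.der (w t + Q) 0 = τ.mild x F t + W21.der Q 0 := fun t ht => by
    rw [← (hw t ht).1]; rfl
  have hop : ∀ t, 0 ≤ t → P.diffOp (w t + Q) = τ.orbit y t + τ.orbit F t := fun t ht => by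
    have : P.diffOp (w t + Q) = P.diffOp (w t) + F := map_add P.diffOpLinear (w t) Q
    rw [this, (hw t ht).2]
    abel
  have hcd : ContDiffOn ℝ 1 (fun t => W21.der (w t + Q) 0) (Ici 0) :=
    ((τ.contDiffOn_mild hgen F).add contDiffOn_const).congr hder
  refine ⟨fun t => w t + Q, ⟨?_, hcd, fun t ht => ?_, ?_, fun t _ => ?_, fun t _ i => ?_⟩, hder⟩
  · exact P.continuousOn_of_der_of_diffOp hcd.continuousOn
      (((τ.continuous_orbit y).add (τ.continuous_orbit F)).continuousOn.congr hop)
  · rw [hop t (le_of_lt ht)]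
    exact (((τ.hasDerivWithinAt_mild hgen F (le_of_lt ht)).hasDerivAt (Ici_mem_nhds ht)).add_const
      (W21.der Q 0)).congr_of_eventuallyEq (Filter.mem_of_superset (Ici_mem_nhds ht) hder)
  · refine W21.ext_der ?_
    rw [hder 0 le_rfl, τ.mild_zero]
    exact sub_add_cancel _ _
  · rw [transmission_iff, map_add, (P.transmission_iff Q).1 hQ, add_zero]
    exact (P.transmission_iff _).1 (mem_domain.1 (hwd t)).2
  · have : P.outerValue (w t + Q) = P.outerValue u₀ := by
      rw [map_add, hout]
      exact add_eq_right.2 (hwd t).1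
    exact congrFun this i

/-- The difference of two solutions has zero outer values and satisfies the transmission conditions,
so it solves the homogeneous Cauchy problem and is the orbit of `0`. -/
theorem IsSolution.eqOn {τ : ContractionSemigroup P.L1} (hτ : τ.generator = P.A₀) {u₀ : P.W21}
    {u v : ℝ → P.W21} (hu : P.IsSolution u₀ u) (hv : P.IsSolution u₀ v) : EqOn v u (Ici 0) := by
  intro t ht
  have hop : ∀ s, P.diffOp (v s) - P.diffOp (u s) = P.diffOp (v s - u s) := fun s =>
    (map_sub P.diffOpLinear (v s) (u s)).symm
  have h := τ.eq_orbit_of_hasDerivAt ht (d := fun s => W21.der (v s) 0 - W21.der (u s) 0)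
    (d' := fun s => P.diffOp (v s - u s))
    ((hv.contDiffOn.continuousOn.sub hu.contDiffOn.continuousOn).mono Icc_subset_Ici_self)
    (fun s hs => hop s ▸ (hv.equation s hs.1).sub (hu.equation s hs.1)) fun s hs => by
      have hmem : v s - u s ∈ P.domain := by
        refine ⟨?_, ?_⟩
        · change P.outerValue (v s - u s) = 0
          rw [map_sub, sub_eq_zero]
          exact funext fun i => (hv.boundary s hs.1 i).trans (hu.boundary s hs.1 i).symm
        · change P.defect (v s - u s) = 0
          rw [map_sub, (P.transmission_iff _).1 (hv.transmission s hs.1),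
            (P.transmission_iff _).1 (hu.transmission s hs.1), sub_self]
      rw [hτ]
      exact ⟨v s - u s, (mem_domain.1 hmem).1, (mem_domain.1 hmem).2, rfl⟩
  have h0 : W21.der (v 0) 0 - W21.der (u 0) 0 = 0 := by rw [hv.initial, hu.initial, sub_self]
  rw [h0] at h
  refine W21.ext_der (sub_eq_zero.1 (h.trans ?_))
  exact map_zero (τ.op t.toNNReal)

end StarNetwork

end

theorem theorem2p5 {ι : Type*} [Fintype ι] (P : StarNetwork ι) :
    IsMDissipative P.A₀ ∧
    (∃! τ : ContractionSemigroup P.L1, τ.generator = P.A₀) ∧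
    ∀ u₀ : P.W21, P.Transmission u₀ →
      (∃ q : ι → ℝ → ℝ, P.IsLift u₀ q) ∧
      ∃ u : ℝ → P.W21, P.IsSolution u₀ u ∧
        (∀ v : ℝ → P.W21, P.IsSolution u₀ v → EqOn v u (Ici 0)) ∧
        ∀ τ : ContractionSemigroup P.L1, τ.generator = P.A₀ →
        ∀ q : ι → ℝ → ℝ, P.IsLift u₀ q →
        ∃ Q F : P.L1, P.IsClassOf Q q ∧ P.IsClassOf F (P.source q) ∧
          ∀ t : ℝ, 0 ≤ t →
            StarNetwork.W21.der (u t) 0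
              = τ.op t.toNNReal (StarNetwork.W21.der u₀ 0 - Q)
                + (∫ s in (0 : ℝ)..t, τ.op (t - s).toNNReal F) + Q := by
  obtain ⟨τ₀, hτ₀, hτ₀u⟩ := P.existsUnique_semigroup
  refine ⟨P.isMDissipative, ⟨τ₀, hτ₀, hτ₀u⟩, fun u₀ hu₀ => ?_⟩
  obtain ⟨q₀, hq₀⟩ := P.exists_isLift u₀
  obtain ⟨Q₀, -, -, hQ₀, hQ₀'⟩ := hq₀.exists_W21
  obtain ⟨u, hu, -⟩ := StarNetwork.exists_isSolution hτ₀ hu₀ hQ₀ hQ₀'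
  refine ⟨⟨q₀, hq₀⟩, u, hu, fun v hv => hu.eqOn hτ₀ hv, fun τ hτ q hq => ?_⟩
  obtain ⟨Q, hQq, hF, hQ, hQ'⟩ := hq.exists_W21
  obtain ⟨v, hv, hv'⟩ := StarNetwork.exists_isSolution hτ hu₀ hQ hQ'
  refine ⟨_, _, hQq, hF, fun t ht => ?_⟩
  -- Each lift produces its own solution `v`; uniqueness identifies it with `u`, so the formula
  -- holds for every lift.
  rw [hv.eqOn hτ hu ht, hv' t ht, τ.mild_eq]
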